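/- Let $\mathbb{K}$ be a field. **Regular categories and degree functions.** Call a morphism $e:x\to y$ an *(extremal) epimorphism*, written $x\twoheadrightarrow y$, if it is an epimorphism that does not factor through a proper subobject of $y$ (if $e=i\circ p$ with $i$ a monomorphism, then $i$ is an isomorphism). A category $\mathcal A$ is *regular* (in Knop's sense) if it has a terminal object, every morphism has an image, the pullback $x\times_z y$ exists whenever $x\to z\leftarrow y$ can be completed to a commutative square, the pullback $x\times_z y$ exists for all $x\twoheadrightarrow z$ and $y\to z$, and pullbacks of (extremal) epimorphisms are (extremal) epimorphisms. A *degree function* on $\mathcal A$ is a function $\delta$ from the (extremal) epimorphisms of $\mathcal A$ to $\mathbb K$ with $\delta(\mathrm{Id}_x)=1$, $\delta(e'e)=\delta(e')\delta(e)$ for composable $e,e'$, and $\delta(e')=\delta(e)$ whenever $e'$ is a pullback of $e$. **The category $\mathcal T(\mathcal A,\delta)$.** A *relation* between $x$ and $y$ is an isomorphism class of jointly monic spans $x\leftarrow r\to y$, i.e. a subobject $r$ of $x\times y$ (when this product exists). The category $\mathcal T^0(\mathcal A,\delta)$ has an object $[x]$ for every object $x$ of $\mathcal A$, and its morphisms $[x]\to[y]$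 are the formal $\mathbb K$-linear combinations of relations $\langle r\rangle$ between $x$ and $y$. Composition is bilinear. For $r$ between $x,y$ and $s$ between $y,z$ it is given by $\langle s\rangle\circ\langle r\rangle=\delta(e)\langle s\star r\rangle$ if $r\times_y s$ exists, where $e: r\times_y s\twoheadrightarrow s\star r$ is the (extremal) epimorphism onto the image $s\star r$ of $r\times_y s$ in $x\times z$, and by $\langle s\rangle\circ\langle r\rangle=0$ otherwise. The category $\mathcal T(\mathcal A,\delta)$ is the additive Karoubi envelope of $\mathcal T^0(\mathcal A,\delta)$ (finite formal direct sums, then idempotent completion). If $\mathcal A$ has finite products, the rule $[x]\otimes[y]=[x\times y]$ and the product of relations make it a $\mathbb K$-linear symmetric monoidal category. **Induced functors.** Let $\mathcal A,\mathcal A'$ be regular categories with degree functions $\delta,\delta'$ with values in $\mathbb K$. A functor $H:\mathcal A\to\mathcal A'$ *preserves the degree functions* if it maps (extremal) epimorphisms to (extremal) epimorphisms and $\delta'(H(e))=\delta(e)$ for every (extremal) epimorphism $e$ of $\mathcal A$. It *preserves pullbacks* if it maps pullback squares to pullback squares and a cospan $x\to z\leftarrow y$ in $\mathcal A$ has a pullback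 as soon as its image $H(x)\to H(z)\leftarrow H(y)$ has one. If $H$ has both properties, then $[x]\mapsto[H(x)]$, $\langle r\rangle\mapsto\langle H(r)\rangle$ defines a functor $\mathcal T^0(\mathcal A,\delta)\to\mathcal T^0(\mathcal A',\delta')$, and hence a functor $\overline H:\mathcal T(\mathcal A,\delta)\to\mathcal T(\mathcal A',\delta')$. **Corollary.** Let $F:\mathcal A\rightleftarrows\mathcal A':G$ be a pair of adjoint functors, $G$ left adjoint to $F$, which both preserve the degree functions, and suppose that $G$ preserves pullbacks. (The right adjoint $F$ preserves pullbacks automatically.) Let $\varepsilon:GF\Rightarrow\mathrm{Id}_{\mathcal A}$ and $\eta:\mathrm{Id}_{\mathcal A'}\Rightarrow FG$ be the counit and the unit, and suppose that for all $f:x\to y$ in $\mathcal A$ and $f':x'\to y'$ in $\mathcal A'$ the commutative squares $$\begin{array}{ccc} x' & \xrightarrow{\ \eta_{x'}\ } & FG(x')\\ {\scriptstyle f'}\downarrow & & \downarrow{\scriptstyle FG(f')}\\ y' & \xrightarrow{\ \eta_{y'}\ } & FG(y')\end{array}\qquad\qquad \begin{array}{ccc} GF(x) & \xrightarrow{\ \varepsilon_x\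 } & x\\ {\scriptstyle GF(f)}\downarrow & & \downarrow{\scriptstyle f}\\ GF(y) & \xrightarrow{\ \varepsilon_y\ } & y\end{array}$$ are Cartesian. Then the induced functor $\overline F:\mathcal T(\mathcal A,\delta)\to\mathcal T(\mathcal A',\delta')$, which is $\mathbb K$-linear, and symmetric monoidal when $\mathcal A$ and $\mathcal A'$ have finite products, preserves all limits that exist in $\mathcal T(\mathcal A,\delta)$. -/

import Mathlib

noncomputable section

namespace DeligneKnop

open CategoryTheory CategoryTheory.Limits

universe v u v' u' w

attribute [local simp] prod.lift_fst prod.lift_snd prod.lift_fst_assoc prod.lift_snd_assoc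
  pullback.lift_fst pullback.lift_snd pullback.lift_fst_assoc pullback.lift_snd_assoc

/-- Knop's notion of a regular category. It is weaker than the usual one: pullbacks are only
required to exist when the cospan admits at least one cone, or when one leg is an (extremal)
epimorphism. Epimorphisms are extremal epimorphisms throughout. -/
class RegularCat (A : Type u) [Category.{v} A] : Prop where
  hasTerminal : HasTerminal A
  hasImages : HasImages A
  hasPullback_of_commSq : ∀ {p x y z : A} {a : p ⟶ x} {b : p ⟶ y} {f : x ⟶ z} {g : y ⟶ z},
    CommSq a b f g → HasPullback f g
  hasPullback_of_extremalEpi : ∀ {x y z : A} (f : x ⟶ z) (g : y ⟶ z),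
    ExtremalEpi f → HasPullback f g
  extremalEpi_of_isPullback : ∀ {p x y z : A} {a : p ⟶ x} {b : p ⟶ y} {f : x ⟶ z} {g : y ⟶ z},
    IsPullback a b f g → ExtremalEpi f → ExtremalEpi b

attribute [instance] RegularCat.hasTerminal RegularCat.hasImages

/-- A degree function: a multiplicative function on (extremal) epimorphisms with values in `K`,
invariant under pullback. -/
structure DegreeFunction (K : Type w) [Field K] (A : Type u) [Category.{v} A] where
  deg : ∀ {x y : A} (e : x ⟶ y), ExtremalEpi e → K
  deg_id : ∀ (x : A) (h : ExtremalEpi (𝟙 x)), deg (𝟙 x) h = 1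
  deg_comp : ∀ {x y z : A} (e : x ⟶ y) (e' : y ⟶ z) (h : ExtremalEpi e) (h' : ExtremalEpi e')
    (h'' : ExtremalEpi (e ≫ e')), deg (e ≫ e') h'' = deg e' h' * deg e h
  deg_pullback : ∀ {p x y z : A} {a : p ⟶ x} {b : p ⟶ y} {f : x ⟶ z} {g : y ⟶ z},
    IsPullback a b f g → ∀ (h : ExtremalEpi f) (h' : ExtremalEpi b), deg b h' = deg f h

/-- A jointly monic span from `x` to `y`, that is, a monomorphism into `x × y` whenever this
product exists. -/
structure MonoSpan {A : Type u} [Category.{v} A] (x y : A) where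
  pt : A
  fst : pt ⟶ x
  snd : pt ⟶ y
  jointly_mono : ∀ {t : A} (a b : t ⟶ pt), a ≫ fst = b ≫ fst → a ≫ snd = b ≫ snd → a = b

/-- Two jointly monic spans are equivalent if they are isomorphic over `x` and `y`. -/
def MonoSpan.setoid {A : Type u} [Category.{v} A] (x y : A) : Setoid (MonoSpan x y) where
  r r s := ∃ i : r.pt ≅ s.pt, i.hom ≫ s.fst = r.fst ∧ i.hom ≫ s.snd = r.snd
  iseqv :=
    { refl := fun r => ⟨Iso.refl _, by simp, by simp⟩
      symm := fun ⟨i, h1, h2⟩ => ⟨i.symm, by simp [← h1], by simp [← h2]⟩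
      trans := fun ⟨i, h1, h2⟩ ⟨j, h3, h4⟩ =>
        ⟨i.trans j, by simp [h1, h3], by simp [h2, h4]⟩ }

/-- A relation between `x` and `y`: an isomorphism class of jointly monic spans, i.e. a
subobject of `x × y`. See `relationEquivSubobject`. -/
def Relation {A : Type u} [Category.{v} A] (x y : A) : Type (max u v) :=
  Quotient (MonoSpan.setoid x y)

/-- The relation defined by a jointly monic span. -/
def MonoSpan.rel {A : Type u} [Category.{v} A] {x y : A} (r : MonoSpan x y) : Relation x y :=
  Quotient.mk (MonoSpan.setoid x y) r

theorem MonoSpan.rel_eq {A : Type u} [Category.{v} A] {x y : A} {r s : MonoSpan x y}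
    (i : r.pt ≅ s.pt) (h1 : i.hom ≫ s.fst = r.fst) (h2 : i.hom ≫ s.snd = r.snd) :
    r.rel = s.rel :=
  Quotient.sound (s := MonoSpan.setoid x y) ⟨i, h1, h2⟩

theorem Relation.exists_rep {A : Type u} [Category.{v} A] {x y : A} (r : Relation x y) :
    ∃ s : MonoSpan x y, s.rel = r := Quotient.exists_rep r

/-- The span attached to a monomorphism into a product. -/
def MonoSpan.ofMono {A : Type u} [Category.{v} A] {x y : A} [HasBinaryProduct x y] {t : A}
    (m : t ⟶ x ⨯ y) [Mono m] : MonoSpan x y where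
  pt := t
  fst := m ≫ prod.fst
  snd := m ≫ prod.snd
  jointly_mono a b h1 h2 := by
    rw [← cancel_mono m]
    ext <;> simpa

theorem MonoSpan.mono_lift {A : Type u} [Category.{v} A] {x y : A} [HasBinaryProduct x y]
    (r : MonoSpan x y) : Mono (prod.lift r.fst r.snd) where
  right_cancellation a b h :=
    r.jointly_mono a b (by simpa using congrArg (fun f => f ≫ prod.fst) h)
      (by simpa using congrArg (fun f => f ≫ prod.snd) h)

/-- If the product `x × y` exists, relations are the same as subobjects of `x × y`. -/
def relationEquivSubobject {A : Type u} [Category.{v} A] (x y : A) [HasBinaryProduct x y] :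
    Relation x y ≃ Subobject (x ⨯ y) where
  toFun := Quotient.lift (s := MonoSpan.setoid x y)
    (fun r => letI := r.mono_lift; Subobject.mk (prod.lift r.fst r.snd))
    (by
      rintro r s ⟨i, h1, h2⟩
      have := r.mono_lift
      have := s.mono_lift
      exact Subobject.mk_eq_mk_of_comm _ _ i (by ext <;> simp [h1, h2]))
  invFun s := (MonoSpan.ofMono s.arrow).rel
  left_inv := by
    intro r
    obtain ⟨r, rfl⟩ := r.exists_rep
    have := r.mono_lift
    refine MonoSpan.rel_eq (Subobject.underlyingIso (prod.lift r.fst r.snd)) ?_ ?_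
    · change _ = Subobject.arrow (Subobject.mk (prod.lift r.fst r.snd)) ≫ prod.fst
      rw [← Subobject.underlyingIso_hom_comp_eq_mk, Category.assoc, prod.lift_fst]; rfl
    · change _ = Subobject.arrow (Subobject.mk (prod.lift r.fst r.snd)) ≫ prod.snd
      rw [← Subobject.underlyingIso_hom_comp_eq_mk, Category.assoc, prod.lift_snd]; rfl
  right_inv s := by
    have := (MonoSpan.ofMono s.arrow).mono_lift
    refine (@Subobject.mk_eq_mk_of_comm _ _ _ _ _ _ s.arrow this _ (Iso.refl _) ?_).trans
      (Subobject.mk_arrow s)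
    ext <;> simp [MonoSpan.ofMono]

theorem extremalEpi_of_isIso {A : Type u} [Category.{v} A] {x y : A} (f : x ⟶ y) [IsIso f] :
    ExtremalEpi f := inferInstance

section Regular

variable {A : Type u} [Category.{v} A] [RegularCat A]

theorem extremalEpi_comp {x y z : A} {e : x ⟶ y} {e' : y ⟶ z} (h : ExtremalEpi e)
    (h' : ExtremalEpi e') : ExtremalEpi (e ≫ e') where
  toEpi := epi_comp _ _
  isIso {t} p i fac _ := by
    have : HasPullback i e' := RegularCat.hasPullback_of_commSq (a := p) (b := e) ⟨fac⟩
    have := h.isIso (pullback.lift p e fac) (pullback.snd i e') (by simp)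
    exact h'.isIso (inv (pullback.snd i e') ≫ pullback.fst i e') i (by
      rw [Category.assoc, pullback.condition, IsIso.inv_hom_id_assoc])

theorem hasBinaryProduct_of_cone {t x y : A} (a : t ⟶ x) (b : t ⟶ y) : HasBinaryProduct x y := by
  have : HasPullback (terminal.from x) (terminal.from y) :=
    RegularCat.hasPullback_of_commSq (a := a) (b := b) ⟨Subsingleton.elim _ _⟩
  have h := IsPullback.of_hasPullback (terminal.from x) (terminal.from y)
  exact ⟨⟨_, BinaryFan.IsLimit.mk (BinaryFan.mk _ _)
    (fun f g => h.lift f g (Subsingleton.elim _ _))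
    (fun f g => h.lift_fst _ _ _) (fun f g => h.lift_snd _ _ _)
    (fun f g m h1 h2 => h.hom_ext (h1.trans (h.lift_fst _ _ _).symm)
      (h2.trans (h.lift_snd _ _ _).symm))⟩⟩

theorem factorThruImage_extremalEpi {x y : A} (f : x ⟶ y) : ExtremalEpi (factorThruImage f) where
  left_cancellation {z} a b h := by
    have : HasBinaryProduct z z := hasBinaryProduct_of_cone a a
    have : HasPullback (prod.lift a b) (prod.lift (𝟙 z) (𝟙 z)) :=
      RegularCat.hasPullback_of_commSq (a := factorThruImage f) (b := factorThruImage f ≫ a)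
        ⟨by ext <;> simp [h]⟩
    let i := pullback.fst (prod.lift a b) (prod.lift (𝟙 z) (𝟙 z))
    have : Mono (prod.lift (𝟙 z) (𝟙 z)) := mono_of_mono_fac (prod.lift_fst (𝟙 z) (𝟙 z))
    let p : x ⟶ pullback (prod.lift a b) (prod.lift (𝟙 z) (𝟙 z)) :=
      pullback.lift (factorThruImage f) (factorThruImage f ≫ a) (by ext <;> simp [h])
    have hp : p ≫ i = factorThruImage f := by simp [p, i]
    let l := image.lift { I := _, m := i ≫ image.ι f, e := p, fac := by
                            rw [← Category.assoc, hp, image.fac] : MonoFactorisation f }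
    have hl : l ≫ i = 𝟙 _ := by
      rw [← cancel_mono (image.ι f), Category.assoc, image.lift_fac, Category.id_comp]
    have hi : i ≫ a = i ≫ b := by
      have hc := pullback.condition (f := prod.lift a b) (g := prod.lift (𝟙 z) (𝟙 z))
      have h1 := congrArg (fun f => f ≫ prod.fst) hc
      have h2 := congrArg (fun f => f ≫ prod.snd) hc
      simp only [Category.assoc, prod.lift_fst, prod.lift_snd] at h1 h2
      exact h1.trans h2.symm
    have := congrArg (fun f => l ≫ f) hi
    simpa [reassoc_of% hl] using this
  isIso {z} p i fac _ := by
    let l := image.lift { I := _, m := i ≫ image.ι f, e := p, fac := by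
                            rw [← Category.assoc, fac, image.fac] : MonoFactorisation f }
    have hl : l ≫ i = 𝟙 _ := by
      rw [← cancel_mono (image.ι f), Category.assoc, image.lift_fac, Category.id_comp]
    exact ⟨l, by rw [← cancel_mono i, Category.assoc, hl]; simp, hl⟩

/-- Every span factors through a jointly monic span by an extremal epimorphism. -/
theorem exists_image {t x y : A} (a : t ⟶ x) (b : t ⟶ y) :
    ∃ (r : MonoSpan x y) (e : t ⟶ r.pt), ExtremalEpi e ∧ e ≫ r.fst = a ∧ e ≫ r.snd = b := by
  have : HasBinaryProduct x y := hasBinaryProduct_of_cone a b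
  refine ⟨MonoSpan.ofMono (image.ι (prod.lift a b)), factorThruImage _,
    factorThruImage_extremalEpi _, ?_, ?_⟩
  · change factorThruImage _ ≫ image.ι _ ≫ prod.fst = _
    simp
  · change factorThruImage _ ≫ image.ι _ ≫ prod.snd = _
    simp

/-- An extremal epimorphism lifts against a jointly monic span. -/
theorem exists_lift {t s x y : A} {e : t ⟶ s} (he : ExtremalEpi e) {r : MonoSpan x y}
    (f : t ⟶ r.pt) (a : s ⟶ x) (b : s ⟶ y) (ha : e ≫ a = f ≫ r.fst) (hb : e ≫ b = f ≫ r.snd) :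
    ∃ l : s ⟶ r.pt, l ≫ r.fst = a ∧ l ≫ r.snd = b := by
  have : HasBinaryProduct x y := hasBinaryProduct_of_cone a b
  have := r.mono_lift
  have w : f ≫ prod.lift r.fst r.snd = e ≫ prod.lift a b := by ext <;> simp [ha, hb]
  have : HasPullback (prod.lift r.fst r.snd) (prod.lift a b) :=
    RegularCat.hasPullback_of_commSq (a := f) (b := e) ⟨w⟩
  have := he.isIso (pullback.lift f e w) (pullback.snd _ _) (by simp)
  have hc : inv (pullback.snd (prod.lift r.fst r.snd) (prod.lift a b)) ≫ pullback.fst _ _ ≫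
      prod.lift r.fst r.snd = prod.lift a b := by
    rw [pullback.condition, IsIso.inv_hom_id_assoc]
  refine ⟨inv (pullback.snd (prod.lift r.fst r.snd) (prod.lift a b)) ≫ pullback.fst _ _, ?_, ?_⟩
  · simpa using congrArg (fun f => f ≫ prod.fst) hc
  · simpa using congrArg (fun f => f ≫ prod.snd) hc

theorem image_unique {t x y : A} {r s : MonoSpan x y} {e : t ⟶ r.pt} {e' : t ⟶ s.pt}
    (he : ExtremalEpi e) (he' : ExtremalEpi e') (h1 : e ≫ r.fst = e' ≫ s.fst)
    (h2 : e ≫ r.snd = e' ≫ s.snd) :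
    ∃ i : r.pt ≅ s.pt, i.hom ≫ s.fst = r.fst ∧ i.hom ≫ s.snd = r.snd ∧ e ≫ i.hom = e' := by
  obtain ⟨l, l1, l2⟩ := exists_lift he e' r.fst r.snd h1 h2
  obtain ⟨m, m1, m2⟩ := exists_lift he' e s.fst s.snd h1.symm h2.symm
  refine ⟨⟨l, m, ?_, ?_⟩, l1, l2, ?_⟩
  · exact r.jointly_mono _ _ (by simp [m1, l1]) (by simp [m2, l2])
  · exact s.jointly_mono _ _ (by simp [m1, l1]) (by simp [m2, l2])
  · exact s.jointly_mono _ _ (by simp [l1, h1]) (by simp [l2, h2])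

end Regular

section Spans

variable {K : Type w} [Field K] {A : Type u} [Category.{v} A] [RegularCat A]
  (δ : DegreeFunction K A)

theorem DegreeFunction.deg_isIso {x y : A} (f : x ⟶ y) [IsIso f] (h : ExtremalEpi f) :
    δ.deg f h = 1 := by
  rw [δ.deg_pullback (IsPullback.of_vert_isIso (⟨by simp⟩ : CommSq f f (𝟙 y) (𝟙 y)))
    (extremalEpi_of_isIso _) h]
  exact δ.deg_id _ _

/-- The multiple `δ(e)⟨r⟩` of a relation attached to an arbitrary span `x ← t → y`,
where `r` is the image of `t` in `x × y` and `e` is the epimorphism from `t` onto `r`. -/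
def spanHom {t x y : A} (a : t ⟶ x) (b : t ⟶ y) : Relation x y →₀ K :=
  Finsupp.single (exists_image a b).choose.rel
    (δ.deg (exists_image a b).choose_spec.choose (exists_image a b).choose_spec.choose_spec.1)

theorem spanHom_eq {t x y : A} {a : t ⟶ x} {b : t ⟶ y} (r : MonoSpan x y) (e : t ⟶ r.pt)
    (he : ExtremalEpi e) (h1 : e ≫ r.fst = a) (h2 : e ≫ r.snd = b) :
    spanHom δ a b = Finsupp.single r.rel (δ.deg e he) := by
  obtain ⟨g0, g1, g2⟩ := (exists_image a b).choose_spec.choose_spec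
  obtain ⟨i, i1, i2, i3⟩ := image_unique g0 he (g1.trans h1.symm) (g2.trans h2.symm)
  subst i3
  unfold spanHom
  rw [MonoSpan.rel_eq i i1 i2, δ.deg_comp _ i.hom g0 (extremalEpi_of_isIso _) he,
    δ.deg_isIso i.hom, one_mul]

theorem spanHom_monoSpan {x y : A} (r : MonoSpan x y) :
    spanHom δ r.fst r.snd = Finsupp.single r.rel 1 := by
  rw [spanHom_eq δ r (𝟙 _) (extremalEpi_of_isIso _) (by simp) (by simp), δ.deg_id]

theorem spanHom_precomp {s t x y : A} (e : s ⟶ t) (he : ExtremalEpi e) (a : t ⟶ x) (b : t ⟶ y) :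
    spanHom δ (e ≫ a) (e ≫ b) = δ.deg e he • spanHom δ a b := by
  obtain ⟨r, f, hf, rfl, rfl⟩ := exists_image a b
  rw [spanHom_eq δ r (e ≫ f) (extremalEpi_comp he hf) (by simp) (by simp),
    spanHom_eq δ r f hf rfl rfl, δ.deg_comp _ _ he hf, Finsupp.smul_single, smul_eq_mul, mul_comm]

theorem spanHom_iso {s t x y : A} (i : s ⟶ t) [IsIso i] {a : t ⟶ x} {b : t ⟶ y} {a' : s ⟶ x}
    {b' : s ⟶ y} (h1 : i ≫ a = a') (h2 : i ≫ b = b') : spanHom δ a' b' = spanHom δ a b := by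
  subst h1 h2
  rw [spanHom_precomp δ i (extremalEpi_of_isIso _), δ.deg_isIso, one_smul]

open scoped Classical in
/-- The composite of two jointly monic spans `r` from `x` to `y` and `s` from `y` to `z`:
it is `δ(e)⟨s ⋆ r⟩`, for `e` the epimorphism of `r ×_y s` onto its image `s ⋆ r` in `x × z`,
if the fibre product exists, and `0` otherwise. -/
def MonoSpan.comp {x y z : A} (r : MonoSpan x y) (s : MonoSpan y z) : Relation x z →₀ K :=
  if _h : HasPullback r.snd s.fst then
    spanHom δ (pullback.fst r.snd s.fst ≫ r.fst) (pullback.snd r.snd s.fst ≫ s.snd)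
  else 0

theorem MonoSpan.comp_of_isPullback {p x y z : A} (r : MonoSpan x y) (s : MonoSpan y z)
    {a : p ⟶ r.pt} {b : p ⟶ s.pt} (h : IsPullback a b r.snd s.fst) :
    r.comp δ s = spanHom δ (a ≫ r.fst) (b ≫ s.snd) := by
  have := h.hasPullback
  rw [MonoSpan.comp, dif_pos this]
  exact (spanHom_iso δ h.isoPullback.hom (by simp) (by simp)).symm

theorem MonoSpan.comp_of_not {x y z : A} (r : MonoSpan x y) (s : MonoSpan y z)
    (h : ∀ {p : A} (a : p ⟶ r.pt) (b : p ⟶ s.pt), a ≫ r.snd ≠ b ≫ s.fst) :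
    r.comp δ s = 0 := by
  rw [MonoSpan.comp, dif_neg]
  intro
  exact h _ _ pullback.condition

/-- Composition of relations, with values in linear combinations of relations. -/
def Relation.comp {x y z : A} (r : Relation x y) (s : Relation y z) : Relation x z →₀ K :=
  Quotient.liftOn₂ (s₁ := MonoSpan.setoid x y) (s₂ := MonoSpan.setoid y z) r s
    (fun r s => r.comp δ s) (by
      rintro r s r' s' ⟨i, i1, i2⟩ ⟨j, j1, j2⟩
      by_cases h : HasPullback r.snd s.fst
      · have hp := IsPullback.of_hasPullback r.snd s.fst
        rw [r.comp_of_isPullback δ s hp, r'.comp_of_isPullback δ s'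
          (IsPullback.of_iso (fst' := pullback.fst r.snd s.fst ≫ i.hom)
            (snd' := pullback.snd r.snd s.fst ≫ j.hom) hp (Iso.refl _) i j (Iso.refl _)
            (by simp) (by simp) (by simp [i2]) (by simp [j1]))]
        simp [i1, j2]
      · rw [MonoSpan.comp_of_not, MonoSpan.comp_of_not]
        · intro p a b hab
          refine h (RegularCat.hasPullback_of_commSq (a := a ≫ i.inv) (b := b ≫ j.inv) ⟨?_⟩)
          simpa [← i2, ← j1] using hab
        · intro p a b hab
          exact h (RegularCat.hasPullback_of_commSq ⟨hab⟩))

/-- The bilinear extension of the composition of relations. -/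
def homComp (x y z : A) :
    (Relation x y →₀ K) →ₗ[K] (Relation y z →₀ K) →ₗ[K] (Relation x z →₀ K) :=
  Finsupp.lift _ K _ fun r => Finsupp.lift _ K _ fun s => r.comp δ s

theorem homComp_single {x y z : A} (r : MonoSpan x y) (s : MonoSpan y z) (c d : K) :
    homComp δ x y z (Finsupp.single r.rel c) (Finsupp.single s.rel d) = c • d • r.comp δ s := by
  simp [homComp]
  rfl

theorem homComp_spanHom {p t s x y z : A} {a : t ⟶ x} {b : t ⟶ y} {c : s ⟶ y} {d : s ⟶ z}
    {f : p ⟶ t} {g : p ⟶ s} (h : IsPullback f g b c) :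
    homComp δ x y z (spanHom δ a b) (spanHom δ c d) = spanHom δ (f ≫ a) (g ≫ d) := by
  obtain ⟨r, e, he, rfl, rfl⟩ := exists_image a b
  obtain ⟨r', e', he', rfl, rfl⟩ := exists_image c d
  rw [spanHom_eq δ r e he rfl rfl, spanHom_eq δ r' e' he' rfl rfl, homComp_single]
  have h1 : HasPullback r.snd r'.fst :=
    RegularCat.hasPullback_of_commSq (a := f ≫ e) (b := g ≫ e') ⟨by simpa using h.w⟩
  have h2 : HasPullback e (pullback.fst r.snd r'.fst) :=
    RegularCat.hasPullback_of_extremalEpi _ _ he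
  have h3 : HasPullback e' (pullback.snd r.snd r'.fst) :=
    RegularCat.hasPullback_of_extremalEpi _ _ he'
  have k1 := IsPullback.of_hasPullback r.snd r'.fst
  have k2 := IsPullback.of_hasPullback e (pullback.fst r.snd r'.fst)
  have k3 := IsPullback.of_hasPullback e' (pullback.snd r.snd r'.fst)
  have hu := RegularCat.extremalEpi_of_isPullback k2 he
  have hv := RegularCat.extremalEpi_of_isPullback k3 he'
  have h4 := RegularCat.hasPullback_of_extremalEpi (pullback.snd e (pullback.fst r.snd r'.fst))
    (pullback.snd e' (pullback.snd r.snd r'.fst)) hu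
  have k4 := IsPullback.of_hasPullback (pullback.snd e (pullback.fst r.snd r'.fst))
    (pullback.snd e' (pullback.snd r.snd r'.fst))
  have hw := RegularCat.extremalEpi_of_isPullback k4 hu
  have big := (k4.flip.paste_horiz k3).paste_vert (k2.flip.paste_horiz k1.flip)
  have d1 := δ.deg_pullback k2 he hu
  have d2 := δ.deg_pullback k4.flip hv (RegularCat.extremalEpi_of_isPullback k4.flip hv)
  have d3 := δ.deg_pullback k3 he' hv
  rw [r.comp_of_isPullback δ r' k1, ← d1, ← d3, ← d2, smul_smul, ← δ.deg_comp _ _ _ _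
    (extremalEpi_comp (RegularCat.extremalEpi_of_isPullback k4.flip hv) hu), ← spanHom_precomp]
  refine spanHom_iso δ (h.isoIsPullback _ _ big.flip).inv ?_ ?_
  · rw [IsPullback.isoIsPullback_inv_fst_assoc]
    simp only [Category.assoc, ← k2.w_assoc]
  · rw [IsPullback.isoIsPullback_inv_snd_assoc]
    simp only [Category.assoc, k3.w_assoc, k4.w_assoc]

theorem homComp_spanHom_zero {t s x y z : A} (a : t ⟶ x) (b : t ⟶ y) (c : s ⟶ y) (d : s ⟶ z)
    (h : ∀ {p : A} (f : p ⟶ t) (g : p ⟶ s), f ≫ b ≠ g ≫ c) :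
    homComp δ x y z (spanHom δ a b) (spanHom δ c d) = 0 := by
  obtain ⟨r, e, he, rfl, rfl⟩ := exists_image a b
  obtain ⟨r', e', he', rfl, rfl⟩ := exists_image c d
  rw [spanHom_eq δ r e he rfl rfl, spanHom_eq δ r' e' he' rfl rfl, homComp_single,
    MonoSpan.comp_of_not, smul_zero, smul_zero]
  intro p f g hfg
  have := RegularCat.hasPullback_of_extremalEpi _ f he
  have := RegularCat.hasPullback_of_extremalEpi _ (pullback.snd e f ≫ g) he'
  refine h (pullback.snd e' (pullback.snd e f ≫ g) ≫ pullback.fst e f)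
    (pullback.fst e' (pullback.snd e f ≫ g)) ?_
  rw [Category.assoc, pullback.condition_assoc, pullback.condition_assoc, hfg, Category.assoc]

end Spans

end DeligneKnop

end

noncomputable section

namespace DeligneKnop

open CategoryTheory CategoryTheory.Limits

universe v u v' u' w

section Skeletal

variable {K : Type w} [Field K] {A : Type u} [Category.{v} A] [RegularCat A]
  (δ : DegreeFunction K A)

theorem span_induction {x y : A} {P : (Relation x y →₀ K) → Prop} (zero : P 0)
    (add : ∀ f g, P f → P g → P (f + g)) (smul : ∀ (c : K) (f), P f → P (c • f))
    (span : ∀ {t : A} (a : t ⟶ x) (b : t ⟶ y), P (spanHom δ a b)) (f : Relation x y →₀ K) :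
    P f := by
  induction f using Finsupp.induction_linear with
  | zero => exact zero
  | add f g hf hg => exact add f g hf hg
  | single r c =>
    obtain ⟨r, rfl⟩ := r.exists_rep
    have := smul c _ (span r.fst r.snd)
    rwa [spanHom_monoSpan, Finsupp.smul_single, smul_eq_mul, mul_one] at this

theorem homComp_id_left {x y : A} (f : Relation x y →₀ K) :
    homComp δ x x y (spanHom δ (𝟙 x) (𝟙 x)) f = f := by
  induction f using span_induction δ with
  | zero => simp
  | add f g hf hg => simp [hf, hg]
  | smul c f hf => simp [hf]
  | span a b =>
    rw [homComp_spanHom δ (IsPullback.of_vert_isIso (⟨by simp⟩ : CommSq a (𝟙 _) (𝟙 x) a))]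
    simp

theorem homComp_id_right {x y : A} (f : Relation x y →₀ K) :
    homComp δ x y y f (spanHom δ (𝟙 y) (𝟙 y)) = f := by
  induction f using span_induction δ with
  | zero => simp
  | add f g hf hg => simp [hf, hg]
  | smul c f hf => simp [hf]
  | span a b =>
    rw [homComp_spanHom δ (IsPullback.of_horiz_isIso (⟨by simp⟩ : CommSq (𝟙 _) b b (𝟙 y)))]
    simp

theorem homComp_assoc {x y z w : A} (f : Relation x y →₀ K) (g : Relation y z →₀ K)
    (h : Relation z w →₀ K) :
    homComp δ x z w (homComp δ x y z f g) h = homComp δ x y w f (homComp δ y z w g h) := by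
  induction f using span_induction δ with
  | zero => simp
  | add f g hf hg => simp [hf, hg]
  | smul c f hf => simp [hf]
  | span a b =>
  induction g using span_induction δ with
  | zero => simp
  | add f g hf hg => simp [hf, hg]
  | smul c f hf => simp [hf]
  | span c d =>
  induction h using span_induction δ with
  | zero => simp
  | add f g hf hg => simp [hf, hg]
  | smul c f hf => simp [hf]
  | span e f =>
  rename_i t₁ t₂ t₃
  by_cases h : ∃ (p : A) (k₁ : p ⟶ t₁) (k₂ : p ⟶ t₂) (k₃ : p ⟶ t₃), k₁ ≫ b = k₂ ≫ c ∧
    k₂ ≫ d = k₃ ≫ e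
  · obtain ⟨p, k₁, k₂, k₃, h1, h2⟩ := h
    have := RegularCat.hasPullback_of_commSq ⟨h1⟩
    have := RegularCat.hasPullback_of_commSq ⟨h2⟩
    have s1 := IsPullback.of_hasPullback b c
    have s2 := IsPullback.of_hasPullback d e
    have : HasPullback (pullback.snd b c) (pullback.fst d e) :=
      RegularCat.hasPullback_of_commSq (a := s1.lift k₁ k₂ h1) (b := s2.lift k₂ k₃ h2) ⟨by simp⟩
    have s3 := IsPullback.of_hasPullback (pullback.snd b c) (pullback.fst d e)
    rw [homComp_spanHom δ s1, homComp_spanHom δ s2,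
      homComp_spanHom δ (s3.flip.paste_horiz s2.flip).flip,
      homComp_spanHom δ (s3.paste_horiz s1)]
    simp
  · rw [not_exists] at h
    trans 0
    · by_cases h1 : ∃ (p : A) (k₁ : p ⟶ t₁) (k₂ : p ⟶ t₂), k₁ ≫ b = k₂ ≫ c
      · obtain ⟨p, k₁, k₂, h1⟩ := h1
        have := RegularCat.hasPullback_of_commSq ⟨h1⟩
        rw [homComp_spanHom δ (IsPullback.of_hasPullback b c), homComp_spanHom_zero]
        intro q l₁ l₂ hl
        refine h q ⟨l₁ ≫ pullback.fst b c, l₁ ≫ pullback.snd b c, l₂, ?_, ?_⟩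
        · simp [pullback.condition]
        · simpa using hl
      · rw [homComp_spanHom_zero δ a b c d (fun k₁ k₂ hk => h1 ⟨_, k₁, k₂, hk⟩)]
        simp
    · by_cases h1 : ∃ (p : A) (k₂ : p ⟶ t₂) (k₃ : p ⟶ t₃), k₂ ≫ d = k₃ ≫ e
      · obtain ⟨p, k₁, k₂, h1⟩ := h1
        have := RegularCat.hasPullback_of_commSq ⟨h1⟩
        rw [homComp_spanHom δ (IsPullback.of_hasPullback d e), homComp_spanHom_zero]
        intro q l₁ l₂ hl
        refine h q ⟨l₁, l₂ ≫ pullback.fst d e, l₂ ≫ pullback.snd d e, ?_, ?_⟩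
        · simpa using hl
        · simp [pullback.condition]
      · rw [homComp_spanHom_zero δ c d e f (fun k₁ k₂ hk => h1 ⟨_, k₁, k₂, hk⟩)]
        simp

/-- The skeletal category `𝒯⁰(A, δ)`: its objects `[x]` are the objects `x` of `A`. -/
structure Skeletal {K : Type w} [Field K] {A : Type u} [Category.{v} A]
    (δ : DegreeFunction K A) where
  obj : A

/-- Morphisms `[x] ⟶ [y]` are formal `K`-linear combinations of relations between `x` and `y`. -/
instance : Category (Skeletal δ) where
  Hom X Y := Relation X.obj Y.obj →₀ K
  id X := spanHom δ (𝟙 X.obj) (𝟙 X.obj)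
  comp f g := homComp δ _ _ _ f g
  id_comp f := homComp_id_left δ f
  comp_id f := homComp_id_right δ f
  assoc f g h := homComp_assoc δ f g h

instance (X Y : Skeletal δ) : AddCommGroup (X ⟶ Y) :=
  inferInstanceAs (AddCommGroup (Relation X.obj Y.obj →₀ K))

instance (X Y : Skeletal δ) : Module K (X ⟶ Y) :=
  inferInstanceAs (Module K (Relation X.obj Y.obj →₀ K))

instance : Preadditive (Skeletal δ) where
  add_comp X Y Z f g h := by
    change homComp δ _ _ _ (_ + _) _ = homComp δ _ _ _ _ _ + homComp δ _ _ _ _ _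
    rw [map_add, LinearMap.add_apply]
  comp_add X Y Z f g h := map_add (homComp δ _ _ _ f) g h

instance : Linear K (Skeletal δ) where
  smul_comp X Y Z c f g := by
    change homComp δ _ _ _ (c • _) _ = c • homComp δ _ _ _ _ _
    rw [map_smul, LinearMap.smul_apply]
  comp_smul X Y Z f c g := map_smul (homComp δ _ _ _ f) c g

variable {δ}

/-- The morphism of `𝒯⁰(A, δ)` attached to a span: `δ(e)⟨r⟩` for `r` its image. -/
def Skeletal.span {X Y : Skeletal δ} {t : A} (a : t ⟶ X.obj) (b : t ⟶ Y.obj) : X ⟶ Y :=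
  spanHom δ a b

theorem Skeletal.induction {X Y : Skeletal δ} {P : (X ⟶ Y) → Prop} (zero : P 0)
    (add : ∀ f g, P f → P g → P (f + g)) (smul : ∀ (c : K) (f), P f → P (c • f))
    (span : ∀ {t : A} (a : t ⟶ X.obj) (b : t ⟶ Y.obj), P (Skeletal.span a b)) (f : X ⟶ Y) :
    P f :=
  span_induction δ (P := P) zero add smul span f

theorem Skeletal.span_comp {X Y Z : Skeletal δ} {p t s : A} {a : t ⟶ X.obj} {b : t ⟶ Y.obj}
    {c : s ⟶ Y.obj} {d : s ⟶ Z.obj} {f : p ⟶ t} {g : p ⟶ s} (h : IsPullback f g b c) :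
    Skeletal.span a b ≫ Skeletal.span c d = Skeletal.span (f ≫ a) (g ≫ d) :=
  homComp_spanHom δ h

theorem Skeletal.span_comp_zero {X Y Z : Skeletal δ} {t s : A} (a : t ⟶ X.obj) (b : t ⟶ Y.obj)
    (c : s ⟶ Y.obj) (d : s ⟶ Z.obj)
    (h : ∀ {p : A} (f : p ⟶ t) (g : p ⟶ s), f ≫ b ≠ g ≫ c) :
    Skeletal.span a b ≫ Skeletal.span c d = 0 :=
  homComp_spanHom_zero δ a b c d h

theorem Skeletal.span_iso {X Y : Skeletal δ} {s t : A} (i : s ⟶ t) [IsIso i] {a : t ⟶ X.obj}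
    {b : t ⟶ Y.obj} {a' : s ⟶ X.obj} {b' : s ⟶ Y.obj} (h1 : i ≫ a = a') (h2 : i ≫ b = b') :
    (Skeletal.span a' b' : X ⟶ Y) = Skeletal.span a b :=
  spanHom_iso δ i h1 h2

theorem Skeletal.id_eq (X : Skeletal δ) : 𝟙 X = Skeletal.span (𝟙 X.obj) (𝟙 X.obj) := rfl

/-- The morphism `⟨Γ f⟩` given by the graph of `f`. -/
def Skeletal.graph {X Y : Skeletal δ} (f : X.obj ⟶ Y.obj) : X ⟶ Y := Skeletal.span (𝟙 _) f

theorem Skeletal.span_comp_graph {X Y Z : Skeletal δ} {t : A} (a : t ⟶ X.obj) (b : t ⟶ Y.obj)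
    (f : Y.obj ⟶ Z.obj) :
    Skeletal.span a b ≫ Skeletal.graph f = Skeletal.span a (b ≫ f) := by
  rw [Skeletal.graph, Skeletal.span_comp
    (IsPullback.of_horiz_isIso (⟨by simp⟩ : CommSq (𝟙 _) b b (𝟙 _)))]
  simp

theorem Skeletal.graph_comp {X Y Z : Skeletal δ} (f : X.obj ⟶ Y.obj) (g : Y.obj ⟶ Z.obj) :
    (Skeletal.graph (f ≫ g) : X ⟶ Z) = Skeletal.graph (Y := Y) f ≫ Skeletal.graph g :=
  (Skeletal.span_comp_graph _ _ _).symm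

theorem Skeletal.graph_comp_span {X Y Z : Skeletal δ} {t : A} (i : X.obj ≅ Y.obj)
    (a : t ⟶ Y.obj) (b : t ⟶ Z.obj) :
    Skeletal.graph i.hom ≫ Skeletal.span a b = Skeletal.span (a ≫ i.inv) b := by
  rw [Skeletal.graph, Skeletal.span_comp
    (IsPullback.of_vert_isIso (⟨by simp⟩ : CommSq (a ≫ i.inv) (𝟙 _) i.hom a))]
  simp

/-- The isomorphism of `𝒯⁰(A, δ)` given by the graph of an isomorphism. -/
def Skeletal.graphIso {X Y : Skeletal δ} (i : X.obj ≅ Y.obj) : X ≅ Y where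
  hom := Skeletal.graph i.hom
  inv := Skeletal.graph i.inv
  hom_inv_id := by rw [← Skeletal.graph_comp, i.hom_inv_id]; rfl
  inv_hom_id := by rw [← Skeletal.graph_comp, i.inv_hom_id]; rfl

/-- The embedding `A ⥤ 𝒯⁰(A, δ)` given by graphs. -/
def graphFunctor (δ : DegreeFunction K A) : A ⥤ Skeletal δ where
  obj x := ⟨x⟩
  map f := Skeletal.graph f
  map_comp f g := Skeletal.graph_comp (δ := δ) (X := ⟨_⟩) (Y := ⟨_⟩) (Z := ⟨_⟩) f g

end Skeletal

section Functoriality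

variable {K : Type w} [Field K] {A : Type u} [Category.{v} A] {A' : Type u'} [Category.{v'} A']

/-- A functor preserves the degree functions if it preserves (extremal) epimorphisms and their
degrees. -/
structure PreservesDegree (F : A ⥤ A') (δ : DegreeFunction K A) (δ' : DegreeFunction K A') :
    Prop where
  map_extremalEpi : ∀ {x y : A} (e : x ⟶ y), ExtremalEpi e → ExtremalEpi (F.map e)
  map_deg : ∀ {x y : A} (e : x ⟶ y) (h : ExtremalEpi e) (h' : ExtremalEpi (F.map e)),
    δ'.deg (F.map e) h' = δ.deg e h

/-- Preservation of pullbacks, in categories where not all pullbacks exist: a cospan of `A` has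
a pullback as soon as its image under `F` has one, and `F` maps pullback squares to pullback
squares. -/
structure PreservesPullbacks (F : A ⥤ A') : Prop where
  map_isPullback : ∀ {p x y z : A} {a : p ⟶ x} {b : p ⟶ y} {f : x ⟶ z} {g : y ⟶ z},
    IsPullback a b f g → IsPullback (F.map a) (F.map b) (F.map f) (F.map g)
  hasPullback : ∀ {x y z : A} (f : x ⟶ z) (g : y ⟶ z),
    HasPullback (F.map f) (F.map g) → HasPullback f g

theorem preservesPullbacks_of_adjunction [RegularCat A] {F : A ⥤ A'} {G : A' ⥤ A} (adj : G ⊣ F) :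
    PreservesPullbacks F where
  map_isPullback h := by
    have := adj.rightAdjoint_preservesLimits
    exact h.map F
  hasPullback f g h := by
    refine RegularCat.hasPullback_of_commSq
      (a := (adj.homEquiv _ _).symm (pullback.fst (F.map f) (F.map g)))
      (b := (adj.homEquiv _ _).symm (pullback.snd (F.map f) (F.map g))) ⟨?_⟩
    rw [← adj.homEquiv_naturality_right_symm, ← adj.homEquiv_naturality_right_symm,
      pullback.condition]

/-- The image of a relation under a functor preserving pullbacks. -/
def MonoSpan.map [RegularCat A] {F : A ⥤ A'} (hF : PreservesPullbacks F) {x y : A}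
    (r : MonoSpan x y) : MonoSpan (F.obj x) (F.obj y) where
  pt := F.obj r.pt
  fst := F.map r.fst
  snd := F.map r.snd
  jointly_mono {t} a b h1 h2 := by
    have : HasPullback (terminal.from x) (terminal.from y) :=
      RegularCat.hasPullback_of_commSq (a := r.fst) (b := r.snd) ⟨Subsingleton.elim _ _⟩
    have hp := IsPullback.of_hasPullback (terminal.from x) (terminal.from y)
    have w := Subsingleton.elim (r.fst ≫ terminal.from x) (r.snd ≫ terminal.from y)
    let l := hp.lift r.fst r.snd w
    have hl : Mono l := ⟨fun f g h => r.jointly_mono _ _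
      (by simpa [l] using congrArg (fun k => k ≫ pullback.fst _ _) h)
      (by simpa [l] using congrArg (fun k => k ≫ pullback.snd _ _) h)⟩
    have hk := hF.map_isPullback (IsKernelPair.id_of_mono l)
    have hab : a ≫ F.map l = b ≫ F.map l := by
      apply (hF.map_isPullback hp).hom_ext
      · simpa [← F.map_comp, l] using h1
      · simpa [← F.map_comp, l] using h2
    exact (by simpa using (hk.lift_fst a b hab).symm : a = hk.lift a b hab).trans
      (by simpa using hk.lift_snd a b hab)

/-- The map on relations induced by a functor preserving pullbacks. -/
def Relation.map [RegularCat A] {F : A ⥤ A'} (hF : PreservesPullbacks F) {x y : A} :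
    Relation x y → Relation (F.obj x) (F.obj y) :=
  Quotient.map (sa := MonoSpan.setoid x y) (sb := MonoSpan.setoid (F.obj x) (F.obj y))
    (MonoSpan.map hF) (by
      rintro r s ⟨i, h1, h2⟩
      exact ⟨F.mapIso i, by simp [MonoSpan.map, ← F.map_comp, h1],
        by simp [MonoSpan.map, ← F.map_comp, h2]⟩)

variable [RegularCat A] [RegularCat A'] {F : A ⥤ A'} {δ : DegreeFunction K A}
  {δ' : DegreeFunction K A'} (hp : PreservesPullbacks F) (hd : PreservesDegree F δ δ')

theorem mapDomain_spanHom (hd : PreservesDegree F δ δ') {t x y : A} (a : t ⟶ x) (b : t ⟶ y) :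
    Finsupp.mapDomain (Relation.map hp) (spanHom δ a b) =
      spanHom δ' (F.map a) (F.map b) := by
  obtain ⟨r, e, he, rfl, rfl⟩ := exists_image a b
  rw [spanHom_eq δ r e he rfl rfl, spanHom_eq δ' (r.map hp) (F.map e) (hd.map_extremalEpi e he)
    (F.map_comp _ _).symm (F.map_comp _ _).symm, Finsupp.mapDomain_single]
  exact congrArg _ (hd.map_deg e he _).symm

/-- The functor `𝒯⁰(A, δ) ⥤ 𝒯⁰(A', δ')` induced by a functor preserving pullbacks and degrees:
it maps `[x]` to `[F x]` and `⟨r⟩` to `⟨F r⟩`. -/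
def skeletalFunctor : Skeletal δ ⥤ Skeletal δ' where
  obj X := ⟨F.obj X.obj⟩
  map f := Finsupp.mapDomain (Relation.map hp) f
  map_id X := by
    rw [Skeletal.id_eq, Skeletal.id_eq]
    refine (mapDomain_spanHom hp hd _ _).trans ?_
    rw [F.map_id]; rfl
  map_comp {X Y Z} f g := by
    change Finsupp.mapDomain _ (homComp δ _ _ _ f g) = homComp δ' _ _ _ _ _
    induction f using span_induction δ with
    | zero => simp
    | add f g hf hg => simp [hf, hg, Finsupp.mapDomain_add]
    | smul c f hf => simp [hf, Finsupp.mapDomain_smul]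
    | span a b =>
    induction g using span_induction δ with
    | zero => simp
    | add f g hf hg => simp [hf, hg, Finsupp.mapDomain_add]
    | smul c f hf => simp [hf, Finsupp.mapDomain_smul]
    | span c d =>
    rw [mapDomain_spanHom hp hd, mapDomain_spanHom hp hd]
    by_cases h : HasPullback b c
    · have h := IsPullback.of_hasPullback b c
      rw [homComp_spanHom δ h, homComp_spanHom δ' (hp.map_isPullback h), mapDomain_spanHom hp hd]
      simp
    · rw [homComp_spanHom_zero δ, homComp_spanHom_zero δ']
      · simp
      · intro p f g hfg
        exact h (hp.hasPullback _ _ (RegularCat.hasPullback_of_commSq ⟨hfg⟩))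
      · intro p f g hfg
        exact h (RegularCat.hasPullback_of_commSq ⟨hfg⟩)

theorem skeletalFunctor_span {X Y : Skeletal δ} {t : A} (a : t ⟶ X.obj) (b : t ⟶ Y.obj) :
    (skeletalFunctor hp hd).map (Skeletal.span a b) = Skeletal.span (F.map a) (F.map b) :=
  mapDomain_spanHom hp hd a b

instance : (skeletalFunctor hp hd).Additive where
  map_add := Finsupp.mapDomain_add

instance : (skeletalFunctor hp hd).Linear K where
  map_smul f c := Finsupp.mapDomain_smul c f

end Functoriality

end DeligneKnop

end

noncomputable section

namespace DeligneKnop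

open CategoryTheory CategoryTheory.Limits MonoidalCategory CartesianMonoidalCategory

universe v u v' u' w

section Tensor

variable {K : Type w} [Field K] {A : Type u} [Category.{v} A] [CartesianMonoidalCategory A]

/-- The product `r × s ⊂ (x × x') × (y × y')` of `r ⊂ x × y` and `s ⊂ x' × y'`. -/
def MonoSpan.tensor {x y x' y' : A} (r : MonoSpan x y) (s : MonoSpan x' y') :
    MonoSpan (x ⊗ x') (y ⊗ y') where
  pt := r.pt ⊗ s.pt
  fst := r.fst ⊗ₘ s.fst
  snd := r.snd ⊗ₘ s.snd
  jointly_mono a b h1 h2 := by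
    apply CartesianMonoidalCategory.hom_ext
    · apply r.jointly_mono
      · simpa using congrArg (fun k => k ≫ CartesianMonoidalCategory.fst _ _) h1
      · simpa using congrArg (fun k => k ≫ CartesianMonoidalCategory.fst _ _) h2
    · apply s.jointly_mono
      · simpa using congrArg (fun k => k ≫ CartesianMonoidalCategory.snd _ _) h1
      · simpa using congrArg (fun k => k ≫ CartesianMonoidalCategory.snd _ _) h2

/-- The product of relations. -/
def Relation.tensor {x y x' y' : A} :
    Relation x y → Relation x' y' → Relation (x ⊗ x') (y ⊗ y') :=
  Quotient.map₂ (sa := MonoSpan.setoid x y) (sb := MonoSpan.setoid x' y')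
    (sc := MonoSpan.setoid (x ⊗ x') (y ⊗ y')) MonoSpan.tensor (by
      rintro r s ⟨i, h1, h2⟩ r' s' ⟨j, h3, h4⟩
      exact ⟨i ⊗ᵢ j, by simp [MonoSpan.tensor, h1, h3], by simp [MonoSpan.tensor, h2, h4]⟩)

/-- The bilinear extension of the product of relations. -/
def homTensor (K : Type w) [Field K] (x y x' y' : A) :
    (Relation x y →₀ K) →ₗ[K] (Relation x' y' →₀ K) →ₗ[K] (Relation (x ⊗ x') (y ⊗ y') →₀ K) :=
  Finsupp.lift _ K _ fun r => Finsupp.lift _ K _ fun s => Finsupp.single (r.tensor s) 1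

theorem homTensor_single {x y x' y' : A} (r : Relation x y) (s : Relation x' y') (c d : K) :
    homTensor K x y x' y' (Finsupp.single r c) (Finsupp.single s d) =
      Finsupp.single (r.tensor s) (c * d) := by
  simp [homTensor]

theorem isPullback_whiskerRight {x y : A} (e : x ⟶ y) (z : A) :
    IsPullback (fst x z) (e ▷ z) e (fst y z) :=
  ⟨⟨by simp⟩, ⟨PullbackCone.IsLimit.mk _ (fun s => lift s.fst (s.snd ≫ snd _ _))
    (fun s => by simp)
    (fun s => by apply CartesianMonoidalCategory.hom_ext <;> simp [s.condition])
    (fun s m h1 h2 => by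
      apply CartesianMonoidalCategory.hom_ext
      · simpa using h1
      · simpa using congrArg (fun k => k ≫ snd _ _) h2)⟩⟩

theorem isPullback_whiskerLeft {x y : A} (z : A) (e : x ⟶ y) :
    IsPullback (snd z x) (z ◁ e) e (snd z y) :=
  ⟨⟨by simp⟩, ⟨PullbackCone.IsLimit.mk _ (fun s => lift (s.snd ≫ fst _ _) s.fst)
    (fun s => by simp)
    (fun s => by apply CartesianMonoidalCategory.hom_ext <;> simp [s.condition])
    (fun s m h1 h2 => by
      apply CartesianMonoidalCategory.hom_ext
      · simpa using congrArg (fun k => k ≫ fst _ _) h2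
      · simpa using h1)⟩⟩

theorem isPullback_tensor {p x y z p' x' y' z' : A} {a : p ⟶ x} {b : p ⟶ y} {f : x ⟶ z}
    {g : y ⟶ z} {a' : p' ⟶ x'} {b' : p' ⟶ y'} {f' : x' ⟶ z'} {g' : y' ⟶ z'}
    (h : IsPullback a b f g) (h' : IsPullback a' b' f' g') :
    IsPullback (a ⊗ₘ a') (b ⊗ₘ b') (f ⊗ₘ f') (g ⊗ₘ g') :=
  have key (s : PullbackCone (f ⊗ₘ f') (g ⊗ₘ g')) :
      (s.fst ≫ fst _ _) ≫ f = (s.snd ≫ fst _ _) ≫ g ∧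
      (s.fst ≫ snd _ _) ≫ f' = (s.snd ≫ snd _ _) ≫ g' :=
    ⟨by simpa using congrArg (fun k => k ≫ fst _ _) s.condition,
      by simpa using congrArg (fun k => k ≫ snd _ _) s.condition⟩
  ⟨⟨by simp [h.w, h'.w]⟩, ⟨PullbackCone.IsLimit.mk _
    (fun s => lift (h.lift _ _ (key s).1) (h'.lift _ _ (key s).2))
    (fun s => by apply CartesianMonoidalCategory.hom_ext <;> simp)
    (fun s => by apply CartesianMonoidalCategory.hom_ext <;> simp)
    (fun s m h1 h2 => by
      have h3 := congrArg (fun k => k ≫ fst _ _) h1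
      have h4 := congrArg (fun k => k ≫ snd _ _) h1
      have h5 := congrArg (fun k => k ≫ fst _ _) h2
      have h6 := congrArg (fun k => k ≫ snd _ _) h2
      simp only [Category.assoc, tensorHom_fst, tensorHom_snd] at h3 h4 h5 h6
      apply CartesianMonoidalCategory.hom_ext
      · apply h.hom_ext <;> simp [h3, h5]
      · apply h'.hom_ext <;> simp [h4, h6])⟩⟩

variable [RegularCat A] (δ : DegreeFunction K A)

theorem extremalEpi_tensor {x y x' y' : A} {e : x ⟶ y} {e' : x' ⟶ y'} (h : ExtremalEpi e)
    (h' : ExtremalEpi e') : ExtremalEpi (e ⊗ₘ e') := by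
  rw [MonoidalCategory.tensorHom_def]
  exact extremalEpi_comp (RegularCat.extremalEpi_of_isPullback (isPullback_whiskerRight e x') h)
    (RegularCat.extremalEpi_of_isPullback (isPullback_whiskerLeft y e') h')

theorem DegreeFunction.deg_tensor {x y x' y' : A} {e : x ⟶ y} {e' : x' ⟶ y'} (h : ExtremalEpi e)
    (h' : ExtremalEpi e') :
    δ.deg (e ⊗ₘ e') (extremalEpi_tensor h h') = δ.deg e h * δ.deg e' h' := by
  have h1 := RegularCat.extremalEpi_of_isPullback (isPullback_whiskerRight e x') h
  have h2 := RegularCat.extremalEpi_of_isPullback (isPullback_whiskerLeft y e') h'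
  rw [← δ.deg_pullback (isPullback_whiskerRight e x') h h1,
    ← δ.deg_pullback (isPullback_whiskerLeft y e') h' h2, mul_comm,
    ← δ.deg_comp _ _ h1 h2 (extremalEpi_comp h1 h2)]
  congr 1
  exact MonoidalCategory.tensorHom_def _ _

theorem homTensor_spanHom {t x y t' x' y' : A} (a : t ⟶ x) (b : t ⟶ y) (a' : t' ⟶ x')
    (b' : t' ⟶ y') :
    homTensor K x y x' y' (spanHom δ a b) (spanHom δ a' b') =
      spanHom δ (a ⊗ₘ a') (b ⊗ₘ b') := by
  obtain ⟨r, e, he, rfl, rfl⟩ := exists_image a b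
  obtain ⟨r', e', he', rfl, rfl⟩ := exists_image a' b'
  rw [spanHom_eq δ r e he rfl rfl, spanHom_eq δ r' e' he' rfl rfl, homTensor_single,
    spanHom_eq δ (r.tensor r') (e ⊗ₘ e') (extremalEpi_tensor he he')
      (tensorHom_comp_tensorHom _ _ _ _) (tensorHom_comp_tensorHom _ _ _ _)]
  exact congrArg _ (δ.deg_tensor he he').symm

variable {δ}

/-- `[x] ⊗ [y] = [x × y]`, with the product of relations on morphisms; the structure isomorphisms
are the graphs of those of the cartesian product of `A`. -/
instance : MonoidalCategoryStruct (Skeletal δ) where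
  tensorObj X Y := ⟨X.obj ⊗ Y.obj⟩
  tensorUnit := ⟨𝟙_ A⟩
  tensorHom {X₁ Y₁ X₂ Y₂} f g := homTensor K X₁.obj Y₁.obj X₂.obj Y₂.obj f g
  whiskerLeft X Y₁ Y₂ f := homTensor K X.obj X.obj Y₁.obj Y₂.obj (𝟙 X : X ⟶ X) f
  whiskerRight {Y₁ Y₂} f X := homTensor K Y₁.obj Y₂.obj X.obj X.obj f (𝟙 X : X ⟶ X)
  associator X Y Z := Skeletal.graphIso (α_ X.obj Y.obj Z.obj)
  leftUnitor X := Skeletal.graphIso (λ_ X.obj)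
  rightUnitor X := Skeletal.graphIso (ρ_ X.obj)

theorem Skeletal.span_tensor {X Y X' Y' : Skeletal δ} {t t' : A} (a : t ⟶ X.obj) (b : t ⟶ Y.obj)
    (a' : t' ⟶ X'.obj) (b' : t' ⟶ Y'.obj) :
    (Skeletal.span a b : X ⟶ Y) ⊗ₘ (Skeletal.span a' b' : X' ⟶ Y') =
      Skeletal.span (X := X ⊗ X') (Y := Y ⊗ Y') (a ⊗ₘ a') (b ⊗ₘ b') :=
  homTensor_spanHom δ a b a' b'

theorem Skeletal.graph_tensor {X Y X' Y' : Skeletal δ} (f : X.obj ⟶ Y.obj) (g : X'.obj ⟶ Y'.obj) :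
    (Skeletal.graph f : X ⟶ Y) ⊗ₘ (Skeletal.graph g : X' ⟶ Y') =
      Skeletal.graph (X := X ⊗ X') (Y := Y ⊗ Y') (f ⊗ₘ g) := by
  rw [Skeletal.graph, Skeletal.graph, Skeletal.span_tensor, id_tensorHom_id]
  rfl

theorem Skeletal.add_tensor {X Y X' Y' : Skeletal δ} (f g : X ⟶ Y) (h : X' ⟶ Y') :
    (f + g) ⊗ₘ h = f ⊗ₘ h + g ⊗ₘ h :=
  LinearMap.congr_fun (map_add (homTensor K X.obj Y.obj X'.obj Y'.obj) f g) h

theorem Skeletal.smul_tensor {X Y X' Y' : Skeletal δ} (c : K) (f : X ⟶ Y) (h : X' ⟶ Y') :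
    (c • f) ⊗ₘ h = c • (f ⊗ₘ h) :=
  LinearMap.congr_fun (map_smul (homTensor K X.obj Y.obj X'.obj Y'.obj) c f) h

theorem Skeletal.zero_tensor {X Y X' Y' : Skeletal δ} (h : X' ⟶ Y') :
    (0 : X ⟶ Y) ⊗ₘ h = 0 :=
  LinearMap.congr_fun (map_zero (homTensor K X.obj Y.obj X'.obj Y'.obj)) h

theorem Skeletal.tensor_add {X Y X' Y' : Skeletal δ} (f : X ⟶ Y) (g h : X' ⟶ Y') :
    f ⊗ₘ (g + h) = f ⊗ₘ g + f ⊗ₘ h :=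
  map_add (homTensor K X.obj Y.obj X'.obj Y'.obj f) g h

theorem Skeletal.tensor_smul {X Y X' Y' : Skeletal δ} (c : K) (f : X ⟶ Y) (h : X' ⟶ Y') :
    f ⊗ₘ (c • h) = c • (f ⊗ₘ h) :=
  map_smul (homTensor K X.obj Y.obj X'.obj Y'.obj f) c h

theorem Skeletal.tensor_zero {X Y X' Y' : Skeletal δ} (f : X ⟶ Y) :
    f ⊗ₘ (0 : X' ⟶ Y') = 0 :=
  map_zero (homTensor K X.obj Y.obj X'.obj Y'.obj f)

attribute [local simp] Skeletal.add_tensor Skeletal.smul_tensor Skeletal.zero_tensor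
  Skeletal.tensor_add Skeletal.tensor_smul Skeletal.tensor_zero

theorem Skeletal.tensor_comp {X₁ Y₁ Z₁ X₂ Y₂ Z₂ : Skeletal δ} (f₁ : X₁ ⟶ Y₁) (f₂ : X₂ ⟶ Y₂)
    (g₁ : Y₁ ⟶ Z₁) (g₂ : Y₂ ⟶ Z₂) :
    (f₁ ⊗ₘ f₂) ≫ (g₁ ⊗ₘ g₂) = (f₁ ≫ g₁) ⊗ₘ (f₂ ≫ g₂) := by
  induction f₁ using Skeletal.induction with
  | zero => simp
  | add f g hf hg => simp [hf, hg]
  | smul c f hf => simp [hf]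
  | span a b =>
  induction f₂ using Skeletal.induction with
  | zero => simp
  | add f g hf hg => simp [hf, hg]
  | smul c f hf => simp [hf]
  | span a' b' =>
  induction g₁ using Skeletal.induction with
  | zero => simp
  | add f g hf hg => simp [hf, hg]
  | smul c f hf => simp [hf]
  | span c d =>
  induction g₂ using Skeletal.induction with
  | zero => simp
  | add f g hf hg => simp [hf, hg]
  | smul c f hf => simp [hf]
  | span c' d' =>
  rw [Skeletal.span_tensor, Skeletal.span_tensor]
  by_cases h : HasPullback b c
  · by_cases h' : HasPullback b' c'
    · have p := IsPullback.of_hasPullback b c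
      have p' := IsPullback.of_hasPullback b' c'
      rw [Skeletal.span_comp p, Skeletal.span_comp p', Skeletal.span_comp (isPullback_tensor p p'),
        Skeletal.span_tensor]
      simp
    · rw [Skeletal.span_comp_zero a' b' c' d', Skeletal.span_comp_zero, Skeletal.tensor_zero]
      · intro p f g hfg
        refine h' (RegularCat.hasPullback_of_commSq (a := f ≫ snd _ _) (b := g ≫ snd _ _) ⟨?_⟩)
        simpa using congrArg (fun k => k ≫ snd _ _) hfg
      · intro p f g hfg
        exact h' (RegularCat.hasPullback_of_commSq ⟨hfg⟩)
  · rw [Skeletal.span_comp_zero a b c d, Skeletal.span_comp_zero, Skeletal.zero_tensor]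
    · intro p f g hfg
      refine h (RegularCat.hasPullback_of_commSq (a := f ≫ fst _ _) (b := g ≫ fst _ _) ⟨?_⟩)
      simpa using congrArg (fun k => k ≫ fst _ _) hfg
    · intro p f g hfg
      exact h (RegularCat.hasPullback_of_commSq ⟨hfg⟩)

theorem Skeletal.span_comp_graphIso_iff {X Y X' Y' : Skeletal δ} {t t' : A} (a : t ⟶ X.obj)
    (b : t ⟶ Y.obj) (a' : t' ⟶ X'.obj) (b' : t' ⟶ Y'.obj) (i : X.obj ≅ X'.obj)
    (j : Y.obj ≅ Y'.obj) (k : t ≅ t') (h1 : a ≫ i.hom = k.hom ≫ a')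
    (h2 : b ≫ j.hom = k.hom ≫ b') :
    (Skeletal.span a b : X ⟶ Y) ≫ (Skeletal.graphIso j : Y ≅ Y').hom =
      (Skeletal.graphIso i : X ≅ X').hom ≫ Skeletal.span a' b' := by
  change Skeletal.span a b ≫ Skeletal.graph j.hom = Skeletal.graph i.hom ≫ Skeletal.span a' b'
  rw [Skeletal.span_comp_graph, Skeletal.graph_comp_span]
  exact Skeletal.span_iso k.hom (by rw [← Category.assoc, ← h1]; simp) h2.symm

theorem Skeletal.graphIso_hom_tensor_id {X Y : Skeletal δ} (i : X.obj ≅ Y.obj)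
    (Z : Skeletal δ) : (Skeletal.graphIso i : X ≅ Y).hom ⊗ₘ 𝟙 Z =
      Skeletal.graph (X := X ⊗ Z) (Y := Y ⊗ Z) (i.hom ▷ Z.obj) :=
  (Skeletal.graph_tensor i.hom (𝟙 Z.obj)).trans (congrArg _ (tensorHom_id _ _))

theorem Skeletal.id_tensor_graphIso_hom (Z : Skeletal δ) {X Y : Skeletal δ}
    (i : X.obj ≅ Y.obj) : 𝟙 Z ⊗ₘ (Skeletal.graphIso i : X ≅ Y).hom =
      Skeletal.graph (X := Z ⊗ X) (Y := Z ⊗ Y) (Z.obj ◁ i.hom) :=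
  (Skeletal.graph_tensor (𝟙 Z.obj) i.hom).trans (congrArg _ (id_tensorHom _ _))

instance : MonoidalCategory (Skeletal δ) := MonoidalCategory.ofTensorHom
  (id_tensorHom_id := fun X Y => by
    rw [Skeletal.id_eq, Skeletal.id_eq, Skeletal.span_tensor]
    simp only [id_tensorHom_id]
    rfl)
  (id_tensorHom := fun _ _ _ _ => rfl)
  (tensorHom_id := fun _ _ => rfl)
  (tensorHom_comp_tensorHom := fun f₁ f₂ g₁ g₂ => Skeletal.tensor_comp f₁ f₂ g₁ g₂)
  (associator_naturality := fun {X₁ X₂ X₃ Y₁ Y₂ Y₃} f₁ f₂ f₃ => by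
    induction f₁ using Skeletal.induction with
    | zero => simp
    | add f g hf hg => simp [hf, hg]
    | smul c f hf => simp [hf]
    | span a b =>
    induction f₂ using Skeletal.induction with
    | zero => simp
    | add f g hf hg => simp [hf, hg]
    | smul c f hf => simp [hf]
    | span a' b' =>
    induction f₃ using Skeletal.induction with
    | zero => simp
    | add f g hf hg => simp [hf, hg]
    | smul c f hf => simp [hf]
    | span a'' b'' =>
    rw [Skeletal.span_tensor, Skeletal.span_tensor, Skeletal.span_tensor, Skeletal.span_tensor]
    exact Skeletal.span_comp_graphIso_iff _ _ _ _ (α_ _ _ _) (α_ _ _ _) (α_ _ _ _)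
      (associator_naturality _ _ _) (associator_naturality _ _ _))
  (leftUnitor_naturality := fun f => by
    induction f using Skeletal.induction with
    | zero => simp
    | add f g hf hg => simp [hf, hg]
    | smul c f hf => simp [hf]
    | span a b =>
    rw [Skeletal.id_eq, Skeletal.span_tensor]
    exact Skeletal.span_comp_graphIso_iff _ _ _ _ (λ_ _) (λ_ _) (λ_ _)
      (by rw [id_tensorHom]; exact leftUnitor_naturality a)
      (by rw [id_tensorHom]; exact leftUnitor_naturality b))
  (rightUnitor_naturality := fun f => by
    induction f using Skeletal.induction with
    | zero => simp
    | add f g hf hg => simp [hf, hg]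
    | smul c f hf => simp [hf]
    | span a b =>
    rw [Skeletal.id_eq, Skeletal.span_tensor]
    exact Skeletal.span_comp_graphIso_iff _ _ _ _ (ρ_ _) (ρ_ _) (ρ_ _)
      (by rw [tensorHom_id]; exact rightUnitor_naturality a)
      (by rw [tensorHom_id]; exact rightUnitor_naturality b))
  (pentagon := fun W X Y Z => by
    have e1 : (α_ W X Y).hom ⊗ₘ 𝟙 Z = _ := Skeletal.graphIso_hom_tensor_id (X := (W ⊗ X) ⊗ Y)
      (Y := W ⊗ X ⊗ Y) (α_ W.obj X.obj Y.obj) Z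
    have e2 : 𝟙 W ⊗ₘ (α_ X Y Z).hom = _ := Skeletal.id_tensor_graphIso_hom W
      (X := (X ⊗ Y) ⊗ Z) (Y := X ⊗ Y ⊗ Z) (α_ X.obj Y.obj Z.obj)
    rw [e1, e2]
    refine (congrArg _ (Skeletal.graph_comp _ _).symm).trans
      ((Skeletal.graph_comp _ _).symm.trans (Eq.trans ?_ (Skeletal.graph_comp _ _)))
    exact congrArg _ (MonoidalCategory.pentagon W.obj X.obj Y.obj Z.obj))
  (triangle := fun X Y => by
    have e1 : (ρ_ X).hom ⊗ₘ 𝟙 Y = _ :=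
      Skeletal.graphIso_hom_tensor_id (X := X ⊗ 𝟙_ (Skeletal δ)) (Y := X) (ρ_ X.obj) Y
    have e2 : 𝟙 X ⊗ₘ (λ_ Y).hom = _ :=
      Skeletal.id_tensor_graphIso_hom X (X := 𝟙_ (Skeletal δ) ⊗ Y) (Y := Y) (λ_ Y.obj)
    rw [e1, e2]
    refine (Skeletal.graph_comp _ _).symm.trans ?_
    exact congrArg _ (MonoidalCategory.triangle X.obj Y.obj))

instance : MonoidalPreadditive (Skeletal δ) where
  whiskerLeft_zero := Skeletal.tensor_zero _
  zero_whiskerRight := Skeletal.zero_tensor _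
  whiskerLeft_add := Skeletal.tensor_add _
  add_whiskerRight f g := Skeletal.add_tensor f g _

instance : MonoidalLinear K (Skeletal δ) where
  whiskerLeft_smul _ _ _ c f := Skeletal.tensor_smul c _ f
  smul_whiskerRight c _ _ f _ := Skeletal.smul_tensor c f _

theorem Skeletal.graph_whiskerRight {X Y : Skeletal δ} (f : X.obj ⟶ Y.obj) (Z : Skeletal δ) :
    (Skeletal.graph f : X ⟶ Y) ▷ Z = Skeletal.graph (X := X ⊗ Z) (Y := Y ⊗ Z) (f ▷ Z.obj) :=
  (Skeletal.graph_tensor f (𝟙 Z.obj)).trans (congrArg _ (tensorHom_id _ _))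

theorem Skeletal.graph_whiskerLeft (Z : Skeletal δ) {X Y : Skeletal δ} (f : X.obj ⟶ Y.obj) :
    Z ◁ (Skeletal.graph f : X ⟶ Y) = Skeletal.graph (X := Z ⊗ X) (Y := Z ⊗ Y) (Z.obj ◁ f) :=
  (Skeletal.graph_tensor (𝟙 Z.obj) f).trans (congrArg _ (id_tensorHom _ _))

theorem Skeletal.span_whiskerRight {X Y : Skeletal δ} {t : A} (a : t ⟶ X.obj) (b : t ⟶ Y.obj)
    (Z : Skeletal δ) :
    (Skeletal.span a b : X ⟶ Y) ▷ Z =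
      Skeletal.span (X := X ⊗ Z) (Y := Y ⊗ Z) (a ▷ Z.obj) (b ▷ Z.obj) :=
  (Skeletal.span_tensor a b (𝟙 Z.obj) (𝟙 Z.obj)).trans
    (congrArg₂ _ (tensorHom_id _ _) (tensorHom_id _ _))

theorem Skeletal.span_whiskerLeft (Z : Skeletal δ) {X Y : Skeletal δ} {t : A} (a : t ⟶ X.obj)
    (b : t ⟶ Y.obj) :
    Z ◁ (Skeletal.span a b : X ⟶ Y) =
      Skeletal.span (X := Z ⊗ X) (Y := Z ⊗ Y) (Z.obj ◁ a) (Z.obj ◁ b) :=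
  (Skeletal.span_tensor (𝟙 Z.obj) (𝟙 Z.obj) a b).trans
    (congrArg₂ _ (id_tensorHom _ _) (id_tensorHom _ _))

variable [BraidedCategory A]

instance : BraidedCategory (Skeletal δ) where
  braiding X Y := Skeletal.graphIso (β_ X.obj Y.obj)
  braiding_naturality_right X {Y Z} f := by
    induction f using Skeletal.induction with
    | zero => simp
    | add f g hf hg => simp [hf, hg]
    | smul c f hf => simp [hf]
    | span a b =>
    rw [Skeletal.span_whiskerLeft, Skeletal.span_whiskerRight]
    exact Skeletal.span_comp_graphIso_iff _ _ _ _ (β_ _ _) (β_ _ _) (β_ _ _) (by simp) (by simp)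
  braiding_naturality_left f Z := by
    induction f using Skeletal.induction with
    | zero => simp
    | add f g hf hg => simp [hf, hg]
    | smul c f hf => simp [hf]
    | span a b =>
    rw [Skeletal.span_whiskerLeft, Skeletal.span_whiskerRight]
    exact Skeletal.span_comp_graphIso_iff _ _ _ _ (β_ _ _) (β_ _ _) (β_ _ _) (by simp) (by simp)
  hexagon_forward X Y Z := by
    refine (congrArg _ (Skeletal.graph_comp _ _).symm).trans
      ((Skeletal.graph_comp _ _).symm.trans (Eq.trans ?_ (congrArg₂ _
        (Skeletal.graph_whiskerRight _ _).symm (congrArg _ (Skeletal.graph_whiskerLeft _ _).symm))))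
    refine Eq.trans ?_ (congrArg _ (Skeletal.graph_comp _ _))
    refine Eq.trans ?_ (Skeletal.graph_comp _ _)
    exact congrArg _ (BraidedCategory.hexagon_forward X.obj Y.obj Z.obj)
  hexagon_reverse X Y Z := by
    refine (congrArg _ (Skeletal.graph_comp _ _).symm).trans
      ((Skeletal.graph_comp _ _).symm.trans (Eq.trans ?_ (congrArg₂ _
        (Skeletal.graph_whiskerLeft _ _).symm (congrArg _ (Skeletal.graph_whiskerRight _ _).symm))))
    refine Eq.trans ?_ (congrArg _ (Skeletal.graph_comp _ _))
    refine Eq.trans ?_ (Skeletal.graph_comp _ _)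
    exact congrArg _ (BraidedCategory.hexagon_reverse X.obj Y.obj Z.obj)

instance : SymmetricCategory (Skeletal δ) where
  symmetry X Y := by
    refine (Skeletal.graph_comp _ _).symm.trans ?_
    have : (β_ X.obj Y.obj).hom ≫ (β_ Y.obj X.obj).hom = 𝟙 _ := by
      apply CartesianMonoidalCategory.hom_ext <;> simp
    exact congrArg _ this

end Tensor

end DeligneKnop

end

noncomputable section

namespace DeligneKnop

open CategoryTheory CategoryTheory.Limits MonoidalCategory

universe v u v' u' w

section MatLinear

variable {K : Type w} [Field K] {C : Type u} [Category.{v} C] [Preadditive C] [Linear K C]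

instance (M N : Mat_ C) : Module K (M ⟶ N) :=
  inferInstanceAs (Module K (∀ i j, M.X i ⟶ N.X j))

@[simp] theorem mat_smul_apply {M N : Mat_ C} (c : K) (f : M ⟶ N) (i : M.ι) (j : N.ι) :
    (c • f) i j = c • f i j := rfl

instance : Linear K (Mat_ C) where
  smul_comp M N P c f g := by
    ext i j
    simp [Finset.smul_sum]
  comp_smul M N P f c g := by
    ext i j
    simp [Finset.smul_sum]

end MatLinear

section MatMono

variable {C : Type u} [Category.{v} C] [Preadditive C]

@[simp] theorem mat_zero_apply {M N : Mat_ C} (i : M.ι) (j : N.ι) :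
    (0 : M ⟶ N) i j = 0 := rfl

open scoped Classical in
/-- The morphism of `Mat_ C` which maps the summand with index `i` to the one with index `e i`
by `φ i`. -/
def reindex {M N : Mat_ C} (e : M.ι → N.ι) (φ : ∀ i, M.X i ⟶ N.X (e i)) : M ⟶ N :=
  fun i j => if h : e i = j then φ i ≫ eqToHom (congrArg N.X h) else 0

@[simp] theorem reindex_apply_self {M N : Mat_ C} (e : M.ι → N.ι) (φ : ∀ i, M.X i ⟶ N.X (e i))
    (i : M.ι) : reindex e φ i (e i) = φ i := by
  simp [reindex]

theorem reindex_apply_of_ne {M N : Mat_ C} {e : M.ι → N.ι} {φ : ∀ i, M.X i ⟶ N.X (e i)}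
    {i : M.ι} {j : N.ι} (h : e i ≠ j) : reindex e φ i j = 0 := by
  simp [reindex, h]

theorem reindex_comp_apply {M N P : Mat_ C} (e : M.ι → N.ι) (φ : ∀ i, M.X i ⟶ N.X (e i))
    (g : N ⟶ P) (i : M.ι) (k : P.ι) : (reindex e φ ≫ g) i k = φ i ≫ g (e i) k := by
  rw [Mat_.comp_apply, Finset.sum_eq_single (e i)]
  · simp
  · intro j _ hj
    rw [reindex_apply_of_ne hj.symm, zero_comp]
  · simp

theorem comp_reindex_apply {M N P : Mat_ C} (f : M ⟶ N) (e : N.ι → P.ι)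
    (he : Function.Injective e) (φ : ∀ i, N.X i ⟶ P.X (e i)) (i : M.ι) (j : N.ι) :
    (f ≫ reindex e φ) i (e j) = f i j ≫ φ j := by
  rw [Mat_.comp_apply, Finset.sum_eq_single j]
  · simp
  · intro k _ hk
    rw [reindex_apply_of_ne (fun h => hk (he h)), comp_zero]
  · simp

theorem reindex_comp_reindex {M N P : Mat_ C} (e : M.ι → N.ι) (φ : ∀ i, M.X i ⟶ N.X (e i))
    (e' : N.ι → P.ι) (ψ : ∀ i, N.X i ⟶ P.X (e' i)) :
    reindex e φ ≫ reindex e' ψ = reindex (e' ∘ e) (fun i => φ i ≫ ψ (e i)) := by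
  ext i k
  rw [reindex_comp_apply]
  by_cases h : e' (e i) = k
  · subst h
    rw [reindex_apply_self]
    exact (reindex_apply_self (e' ∘ e) (fun i => φ i ≫ ψ (e i)) i).symm
  · rw [reindex_apply_of_ne h, reindex_apply_of_ne (e := e' ∘ e) h, comp_zero]

theorem id_eq_reindex (M : Mat_ C) : 𝟙 M = reindex id (fun i => 𝟙 (M.X i)) := by
  ext i j
  by_cases h : i = j
  · subst h
    rw [Mat_.id_apply_self]
    exact (reindex_apply_self (M := M) (N := M) id (fun i => 𝟙 (M.X i)) i).symm
  · rw [Mat_.id_apply_of_ne _ _ _ h, reindex_apply_of_ne (e := id) h]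

theorem reindex_natural {M N M' N' : Mat_ C} (f : M ⟶ N) (f' : M' ⟶ N') (e : M.ι → M'.ι)
    (φ : ∀ i, M.X i ⟶ M'.X (e i)) (e' : N.ι → N'.ι) (ψ : ∀ i, N.X i ⟶ N'.X (e' i))
    (he' : Function.Bijective e') (h : ∀ i j, f i j ≫ ψ j = φ i ≫ f' (e i) (e' j)) :
    f ≫ reindex e' ψ = reindex e φ ≫ f' := by
  ext i k
  obtain ⟨j, rfl⟩ := he'.2 k
  rw [comp_reindex_apply f e' he'.1, reindex_comp_apply, h]

end MatMono

section MatTensor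

variable {C : Type u} [Category.{v} C] [Preadditive C] [MonoidalCategory C]

/-- The tensor product of tuples of objects is the tuple of all tensor products. -/
abbrev matTensorObj (M N : Mat_ C) : Mat_ C :=
  ⟨M.ι × N.ι, fun i => M.X i.1 ⊗ N.X i.2⟩

/-- The tensor product of matrices is the Kronecker product. -/
def matTensorHom {M N M' N' : Mat_ C} (f : M ⟶ N) (g : M' ⟶ N') :
    matTensorObj M M' ⟶ matTensorObj N N' :=
  fun i j => f i.1 j.1 ⊗ₘ g i.2 j.2

theorem matTensorHom_apply {M N M' N' : Mat_ C} (f : M ⟶ N) (g : M' ⟶ N')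
    (i : M.ι × M'.ι) (j : N.ι × N'.ι) : matTensorHom f g i j = f i.1 j.1 ⊗ₘ g i.2 j.2 := rfl

variable [MonoidalPreadditive C]

theorem matTensorHom_reindex {M N M' N' : Mat_ C} (e : M.ι → N.ι) (φ : ∀ i, M.X i ⟶ N.X (e i))
    (e' : M'.ι → N'.ι) (ψ : ∀ i, M'.X i ⟶ N'.X (e' i)) :
    matTensorHom (reindex e φ) (reindex e' ψ) =
      reindex (M := matTensorObj M M') (N := matTensorObj N N') (fun i => (e i.1, e' i.2))
        (fun i => φ i.1 ⊗ₘ ψ i.2) := by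
  ext ⟨i, i'⟩ ⟨j, j'⟩
  rw [matTensorHom_apply]
  have key : (e i, e' i') ≠ (j, j') → reindex (M := matTensorObj M M') (N := matTensorObj N N')
      (fun i => (e i.1, e' i.2)) (fun i => φ i.1 ⊗ₘ ψ i.2) (i, i') (j, j') = 0 :=
    fun h => reindex_apply_of_ne h
  by_cases h : e i = j
  · by_cases h' : e' i' = j'
    · subst h h'
      rw [reindex_apply_self, reindex_apply_self]
      exact (reindex_apply_self (M := matTensorObj M M') (N := matTensorObj N N')
        (fun i => (e i.1, e' i.2)) (fun i => φ i.1 ⊗ₘ ψ i.2) (i, i')).symm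
    · rw [key fun k => h' (congrArg Prod.snd k), reindex_apply_of_ne h',
        MonoidalPreadditive.tensor_zero]
  · rw [key fun k => h (congrArg Prod.fst k), reindex_apply_of_ne h,
      MonoidalPreadditive.zero_tensor]

theorem matTensorHom_id (M N : Mat_ C) : matTensorHom (𝟙 M) (𝟙 N) = 𝟙 (matTensorObj M N) := by
  rw [id_eq_reindex, id_eq_reindex, id_eq_reindex, matTensorHom_reindex]
  exact congrArg (reindex (M := matTensorObj M N) (N := matTensorObj M N) id)
    (funext fun i => id_tensorHom_id _ _)

theorem matTensorHom_comp {M N P M' N' P' : Mat_ C} (f : M ⟶ N) (f' : M' ⟶ N') (g : N ⟶ P)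
    (g' : N' ⟶ P') :
    matTensorHom f f' ≫ matTensorHom g g' = matTensorHom (f ≫ g) (f' ≫ g') := by
  ext ⟨i, i'⟩ ⟨k, k'⟩
  rw [Mat_.comp_apply, matTensorHom_apply, Mat_.comp_apply, Mat_.comp_apply, sum_tensor]
  simp only [tensor_sum]
  rw [← Fintype.sum_prod_type (f := fun p : N.ι × N'.ι => (f i p.1 ≫ g p.1 k) ⊗ₘ
    (f' i' p.2 ≫ g' p.2 k'))]
  exact Finset.sum_congr rfl fun p _ => by
    rw [matTensorHom_apply, matTensorHom_apply, tensorHom_comp_tensorHom]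

instance : MonoidalCategoryStruct (Mat_ C) where
  tensorObj := matTensorObj
  tensorUnit := ⟨PUnit, fun _ => 𝟙_ C⟩
  tensorHom := matTensorHom
  whiskerLeft X _ _ f := matTensorHom (𝟙 X) f
  whiskerRight f X := matTensorHom f (𝟙 X)
  associator X Y Z :=
    { hom := reindex (M := matTensorObj (matTensorObj X Y) Z)
        (N := matTensorObj X (matTensorObj Y Z)) (fun i => (i.1.1, (i.1.2, i.2)))
        (fun i => (α_ (X.X i.1.1) (Y.X i.1.2) (Z.X i.2)).hom)
      inv := reindex (M := matTensorObj X (matTensorObj Y Z))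
        (N := matTensorObj (matTensorObj X Y) Z) (fun i => ((i.1, i.2.1), i.2.2))
        (fun i => (α_ (X.X i.1) (Y.X i.2.1) (Z.X i.2.2)).inv)
      hom_inv_id := by
        rw [reindex_comp_reindex, id_eq_reindex]
        exact congrArg (reindex (M := matTensorObj (matTensorObj X Y) Z)
          (N := matTensorObj (matTensorObj X Y) Z) id) (funext fun i => Iso.hom_inv_id _)
      inv_hom_id := by
        rw [reindex_comp_reindex, id_eq_reindex]
        exact congrArg (reindex (M := matTensorObj X (matTensorObj Y Z))
          (N := matTensorObj X (matTensorObj Y Z)) id) (funext fun i => Iso.inv_hom_id _) }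
  leftUnitor X :=
    { hom := reindex (M := matTensorObj ⟨PUnit, fun _ => 𝟙_ C⟩ X) (N := X) (fun i => i.2)
        (fun i => (λ_ (X.X i.2)).hom)
      inv := reindex (M := X) (N := matTensorObj ⟨PUnit, fun _ => 𝟙_ C⟩ X)
        (fun i => (PUnit.unit, i)) (fun i => (λ_ (X.X i)).inv)
      hom_inv_id := by
        rw [reindex_comp_reindex, id_eq_reindex]
        exact congrArg (reindex (M := matTensorObj ⟨PUnit, fun _ => 𝟙_ C⟩ X)
          (N := matTensorObj ⟨PUnit, fun _ => 𝟙_ C⟩ X) id) (funext fun i => Iso.hom_inv_id _)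
      inv_hom_id := by
        rw [reindex_comp_reindex, id_eq_reindex]
        exact congrArg (reindex (M := X) (N := X) id) (funext fun i => Iso.inv_hom_id _) }
  rightUnitor X :=
    { hom := reindex (M := matTensorObj X ⟨PUnit, fun _ => 𝟙_ C⟩) (N := X) (fun i => i.1)
        (fun i => (ρ_ (X.X i.1)).hom)
      inv := reindex (M := X) (N := matTensorObj X ⟨PUnit, fun _ => 𝟙_ C⟩)
        (fun i => (i, PUnit.unit)) (fun i => (ρ_ (X.X i)).inv)
      hom_inv_id := by
        rw [reindex_comp_reindex, id_eq_reindex]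
        exact congrArg (reindex (M := matTensorObj X ⟨PUnit, fun _ => 𝟙_ C⟩)
          (N := matTensorObj X ⟨PUnit, fun _ => 𝟙_ C⟩) id) (funext fun i => Iso.hom_inv_id _)
      inv_hom_id := by
        rw [reindex_comp_reindex, id_eq_reindex]
        exact congrArg (reindex (M := X) (N := X) id) (funext fun i => Iso.inv_hom_id _) }

instance : MonoidalCategory (Mat_ C) := MonoidalCategory.ofTensorHom
  (id_tensorHom_id := matTensorHom_id)
  (id_tensorHom := fun _ _ _ _ => rfl)
  (tensorHom_id := fun _ _ => rfl)
  (tensorHom_comp_tensorHom := fun f₁ f₂ g₁ g₂ => matTensorHom_comp f₁ f₂ g₁ g₂)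
  (associator_naturality := fun f₁ f₂ f₃ =>
    reindex_natural (matTensorHom (matTensorHom f₁ f₂) f₃) (matTensorHom f₁ (matTensorHom f₂ f₃))
      _ _ _ _ ⟨fun a b h => by grind, fun b => ⟨((b.1, b.2.1), b.2.2), rfl⟩⟩
      fun _ _ => associator_naturality _ _ _)
  (leftUnitor_naturality := fun {X Y} f =>
    reindex_natural (matTensorHom (𝟙 (⟨PUnit, fun _ => 𝟙_ C⟩ : Mat_ C)) f) f
      _ _ _ _ ⟨fun a b h => by grind, fun b => ⟨(PUnit.unit, b), rfl⟩⟩ fun i j => by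
        rw [matTensorHom_apply, Mat_.id_apply_self, id_tensorHom]
        exact leftUnitor_naturality _)
  (rightUnitor_naturality := fun {X Y} f =>
    reindex_natural (matTensorHom f (𝟙 (⟨PUnit, fun _ => 𝟙_ C⟩ : Mat_ C))) f
      _ _ _ _ ⟨fun a b h => by grind, fun b => ⟨(b, PUnit.unit), rfl⟩⟩ fun i j => by
        rw [matTensorHom_apply, Mat_.id_apply_self, tensorHom_id]
        exact rightUnitor_naturality _)
  (pentagon := fun W X Y Z => by
    change matTensorHom (reindex _ _) (𝟙 Z) ≫ reindex _ _ ≫ matTensorHom (𝟙 W) (reindex _ _) =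
      reindex _ _ ≫ reindex _ _
    rw [id_eq_reindex, id_eq_reindex, matTensorHom_reindex, matTensorHom_reindex,
      reindex_comp_reindex, reindex_comp_reindex, reindex_comp_reindex]
    refine congrArg (reindex (M := matTensorObj (matTensorObj (matTensorObj W X) Y) Z)
      (N := matTensorObj W (matTensorObj X (matTensorObj Y Z)))
      (fun i => (i.1.1.1, (i.1.1.2, (i.1.2, i.2))))) (funext fun i => ?_)
    rw [tensorHom_id, id_tensorHom]
    exact MonoidalCategory.pentagon _ _ _ _)
  (triangle := fun X Y => by
    change reindex _ _ ≫ matTensorHom (𝟙 X) (reindex _ _) = matTensorHom (reindex _ _) (𝟙 Y)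
    rw [id_eq_reindex, id_eq_reindex, matTensorHom_reindex, matTensorHom_reindex,
      reindex_comp_reindex]
    refine congrArg (reindex (M := matTensorObj (matTensorObj X ⟨PUnit, fun _ => 𝟙_ C⟩) Y)
      (N := matTensorObj X Y) (fun i => (i.1.1, i.2))) (funext fun i => ?_)
    rw [tensorHom_id, id_tensorHom]
    exact MonoidalCategory.triangle _ _)

instance : MonoidalPreadditive (Mat_ C) where
  whiskerLeft_zero {_ _ _} := Mat_.hom_ext _ _ fun _ _ => MonoidalPreadditive.tensor_zero _
  zero_whiskerRight {_ _ _} := Mat_.hom_ext _ _ fun _ _ => MonoidalPreadditive.zero_tensor _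
  whiskerLeft_add _ _ := Mat_.hom_ext _ _ fun _ _ => MonoidalPreadditive.tensor_add _ _ _
  add_whiskerRight _ _ := Mat_.hom_ext _ _ fun _ _ => MonoidalPreadditive.add_tensor _ _ _

instance {K : Type w} [Field K] [Linear K C] [MonoidalLinear K C] : MonoidalLinear K (Mat_ C) where
  whiskerLeft_smul X _ _ c f := Mat_.hom_ext _ _ fun i j => by
    change (𝟙 X : X ⟶ X) i.1 j.1 ⊗ₘ c • f i.2 j.2 = c • ((𝟙 X : X ⟶ X) i.1 j.1 ⊗ₘ f i.2 j.2)
    simp [MonoidalCategory.tensorHom_def]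
  smul_whiskerRight c _ _ f X := Mat_.hom_ext _ _ fun i j => by
    change (c • f i.1 j.1) ⊗ₘ (𝟙 X : X ⟶ X) i.2 j.2 = c • (f i.1 j.1 ⊗ₘ (𝟙 X : X ⟶ X) i.2 j.2)
    simp [MonoidalCategory.tensorHom_def]

theorem mat_whiskerLeft (X : Mat_ C) {Y Z : Mat_ C} (e : Y.ι → Z.ι)
    (φ : ∀ i, Y.X i ⟶ Z.X (e i)) : X ◁ reindex e φ =
      reindex (M := matTensorObj X Y) (N := matTensorObj X Z) (fun i => (i.1, e i.2))
        (fun i => X.X i.1 ◁ φ i.2) := by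
  change matTensorHom (𝟙 X) (reindex _ _) = _
  rw [id_eq_reindex, matTensorHom_reindex]
  exact congrArg (reindex (M := matTensorObj X Y) (N := matTensorObj X Z) _)
    (funext fun i => id_tensorHom _ _)

theorem mat_whiskerRight {Y Z : Mat_ C} (e : Y.ι → Z.ι) (φ : ∀ i, Y.X i ⟶ Z.X (e i))
    (X : Mat_ C) : reindex e φ ▷ X =
      reindex (M := matTensorObj Y X) (N := matTensorObj Z X) (fun i => (e i.1, i.2))
        (fun i => φ i.1 ▷ X.X i.2) := by
  change matTensorHom (reindex _ _) (𝟙 X) = _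
  rw [id_eq_reindex, matTensorHom_reindex]
  exact congrArg (reindex (M := matTensorObj Y X) (N := matTensorObj Z X) _)
    (funext fun i => tensorHom_id _ _)

variable [SymmetricCategory C]

/-- The symmetry of `Mat_ C`. -/
def matBraiding (X Y : Mat_ C) : matTensorObj X Y ⟶ matTensorObj Y X :=
  reindex (M := matTensorObj X Y) (N := matTensorObj Y X) (fun i => (i.2, i.1))
    (fun i => (β_ (X.X i.1) (Y.X i.2)).hom)

theorem matBraiding_comp (X Y : Mat_ C) : matBraiding X Y ≫ matBraiding Y X = 𝟙 _ := by
  rw [matBraiding, matBraiding, reindex_comp_reindex, id_eq_reindex]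
  exact congrArg (reindex (M := matTensorObj X Y) (N := matTensorObj X Y) id)
    (funext fun i => SymmetricCategory.symmetry _ _)

theorem matBraiding_natural {X Y X' Y' : Mat_ C} (f : X ⟶ Y) (g : X' ⟶ Y') :
    matTensorHom f g ≫ matBraiding Y Y' = matBraiding X X' ≫ matTensorHom g f :=
  reindex_natural _ _ _ _ _ _ ⟨fun a b h => by grind, fun b => ⟨(b.2, b.1), rfl⟩⟩
    fun _ _ => BraidedCategory.braiding_naturality _ _

instance : SymmetricCategory (Mat_ C) where
  braiding X Y := ⟨matBraiding X Y, matBraiding Y X, matBraiding_comp X Y, matBraiding_comp Y X⟩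
  braiding_naturality_right X {_ _} f := matBraiding_natural (𝟙 X) f
  braiding_naturality_left f X := matBraiding_natural f (𝟙 X)
  hexagon_forward X Y Z := by
    change reindex _ _ ≫ reindex _ _ ≫ reindex _ _ =
      reindex _ _ ▷ Z ≫ reindex _ _ ≫ Y ◁ reindex _ _
    rw [mat_whiskerLeft, mat_whiskerRight, reindex_comp_reindex, reindex_comp_reindex,
      reindex_comp_reindex, reindex_comp_reindex]
    exact congrArg (reindex (M := matTensorObj (matTensorObj X Y) Z)
      (N := matTensorObj Y (matTensorObj Z X)) (fun i => (i.1.2, (i.2, i.1.1))))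
      (funext fun i => BraidedCategory.hexagon_forward _ _ _)
  hexagon_reverse X Y Z := by
    change reindex _ _ ≫ reindex _ _ ≫ reindex _ _ =
      X ◁ reindex _ _ ≫ reindex _ _ ≫ reindex _ _ ▷ Y
    rw [mat_whiskerLeft, mat_whiskerRight, reindex_comp_reindex, reindex_comp_reindex,
      reindex_comp_reindex, reindex_comp_reindex]
    exact congrArg (reindex (M := matTensorObj X (matTensorObj Y Z))
      (N := matTensorObj (matTensorObj Z X) Y) (fun i => ((i.2.2, i.1), i.2.1)))
      (funext fun i => BraidedCategory.hexagon_reverse _ _ _)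
  symmetry X Y := matBraiding_comp X Y

end MatTensor

end DeligneKnop

end

noncomputable section

namespace DeligneKnop

open CategoryTheory CategoryTheory.Limits MonoidalCategory CategoryTheory.Idempotents

universe v u v' u' w

section KaroubiLinear

variable {K : Type w} [Field K] {C : Type u} [Category.{v} C] [Preadditive C] [Linear K C]

instance (P Q : Karoubi C) : SMul K (P ⟶ Q) where
  smul c f := ⟨c • f.f, by simp⟩

@[simp] theorem karoubi_smul_f {P Q : Karoubi C} (c : K) (f : P ⟶ Q) : (c • f).f = c • f.f := rfl

instance (P Q : Karoubi C) : Module K (P ⟶ Q) where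
  one_smul f := by ext; simp
  mul_smul c d f := by ext; simp [mul_smul]
  smul_zero c := by ext; simp
  smul_add c f g := by ext; simp
  add_smul c d f := by ext; simp [add_smul]
  zero_smul f := by ext; simp

instance : Linear K (Karoubi C) where
  smul_comp P Q R c f g := by ext; simp
  comp_smul P Q R f c g := by ext; simp

end KaroubiLinear

section KaroubiTensor

variable {C : Type u} [Category.{v} C] [MonoidalCategory C]

/-- `(X, p) ⊗ (Y, q) = (X ⊗ Y, p ⊗ q)`. -/
abbrev karoubiTensorObj (P Q : Karoubi C) : Karoubi C :=
  ⟨P.X ⊗ Q.X, P.p ⊗ₘ Q.p, by simp [tensorHom_comp_tensorHom]⟩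

/-- The tensor product of morphisms in the Karoubi envelope. -/
def karoubiTensorHom {P Q P' Q' : Karoubi C} (f : P ⟶ Q) (g : P' ⟶ Q') :
    karoubiTensorObj P P' ⟶ karoubiTensorObj Q Q' :=
  ⟨f.f ⊗ₘ g.f, by simp [tensorHom_comp_tensorHom]⟩

/-- An isomorphism of `C` compatible with the idempotents gives an isomorphism in the Karoubi
envelope. -/
def karoubiIso {P Q : Karoubi C} (i : P.X ≅ Q.X) (h : P.p ≫ i.hom = i.hom ≫ Q.p) : P ≅ Q where
  hom := ⟨P.p ≫ i.hom, by
    rw [Category.assoc, ← h, P.idem_assoc, P.idem_assoc]⟩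
  inv := ⟨i.inv ≫ P.p, by
    have : Q.p ≫ i.inv = i.inv ≫ P.p := by rw [Iso.comp_inv_eq, Category.assoc, h]; simp
    simp [reassoc_of% this]⟩
  hom_inv_id := by ext; simp
  inv_hom_id := by
    ext
    simp only [Karoubi.comp_f, Category.assoc, Karoubi.id_f]
    rw [← Category.assoc P.p, P.idem, h, Iso.inv_hom_id_assoc]

instance : MonoidalCategoryStruct (Karoubi C) where
  tensorObj := karoubiTensorObj
  tensorUnit := ⟨𝟙_ C, 𝟙 _, by simp⟩
  tensorHom := karoubiTensorHom
  whiskerLeft P _ _ f := karoubiTensorHom (𝟙 P) f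
  whiskerRight f P := karoubiTensorHom f (𝟙 P)
  associator P Q R := karoubiIso (P := karoubiTensorObj (karoubiTensorObj P Q) R)
    (Q := karoubiTensorObj P (karoubiTensorObj Q R)) (α_ P.X Q.X R.X)
    (associator_naturality _ _ _)
  leftUnitor P := karoubiIso (P := karoubiTensorObj ⟨𝟙_ C, 𝟙 _, by simp⟩ P) (Q := P) (λ_ P.X)
    (by simp)
  rightUnitor P := karoubiIso (P := karoubiTensorObj P ⟨𝟙_ C, 𝟙 _, by simp⟩) (Q := P) (ρ_ P.X)
    (by simp)

theorem karoubi_tensorHom_f {P Q P' Q' : Karoubi C} (f : P ⟶ Q) (g : P' ⟶ Q') :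
    (f ⊗ₘ g).f = f.f ⊗ₘ g.f := rfl

theorem karoubi_associator_f (P Q R : Karoubi C) :
    (α_ P Q R).hom.f = ((P.p ⊗ₘ Q.p) ⊗ₘ R.p) ≫ (α_ P.X Q.X R.X).hom := rfl

theorem karoubi_associator_inv_f (P Q R : Karoubi C) :
    (α_ P Q R).inv.f = (α_ P.X Q.X R.X).inv ≫ ((P.p ⊗ₘ Q.p) ⊗ₘ R.p) := rfl

theorem karoubi_leftUnitor_f (P : Karoubi C) :
    (λ_ P).hom.f = (𝟙 (𝟙_ C) ⊗ₘ P.p) ≫ (λ_ P.X).hom := rfl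

theorem karoubi_rightUnitor_f (P : Karoubi C) :
    (ρ_ P).hom.f = (P.p ⊗ₘ 𝟙 (𝟙_ C)) ≫ (ρ_ P.X).hom := rfl

instance : MonoidalCategory (Karoubi C) := MonoidalCategory.ofTensorHom
  (id_tensorHom_id := fun P Q => rfl)
  (id_tensorHom := fun _ _ _ _ => rfl)
  (tensorHom_id := fun _ _ => rfl)
  (tensorHom_comp_tensorHom := fun f₁ f₂ g₁ g₂ => by
    apply Karoubi.hom_ext
    simp only [Karoubi.comp_f, karoubi_tensorHom_f, tensorHom_comp_tensorHom])
  (associator_naturality := fun f₁ f₂ f₃ => by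
    apply Karoubi.hom_ext
    simp only [Karoubi.comp_f, karoubi_tensorHom_f, karoubi_associator_f, Category.assoc]
    rw [← associator_naturality]
    simp only [← Category.assoc, tensorHom_comp_tensorHom, Karoubi.comp_p, Karoubi.p_comp])
  (leftUnitor_naturality := fun f => by
    apply Karoubi.hom_ext
    simp only [Karoubi.comp_f, karoubi_tensorHom_f, karoubi_leftUnitor_f, Category.assoc,
      id_tensorHom]
    rw [← leftUnitor_naturality]
    change (𝟙 (𝟙_ C) ⊗ₘ _) ≫ _ = _
    simp [id_tensorHom])
  (rightUnitor_naturality := fun f => by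
    apply Karoubi.hom_ext
    simp only [Karoubi.comp_f, karoubi_tensorHom_f, karoubi_rightUnitor_f, Category.assoc,
      tensorHom_id]
    rw [← rightUnitor_naturality]
    change (_ ⊗ₘ 𝟙 (𝟙_ C)) ≫ _ = _
    simp [tensorHom_id])
  (pentagon := fun P Q R S => by
    apply Karoubi.hom_ext
    simp only [Karoubi.comp_f, karoubi_tensorHom_f, karoubi_associator_f, Category.assoc,
      Karoubi.id_f]
    have e1 : (((P.p ⊗ₘ Q.p) ⊗ₘ R.p) ≫ (α_ P.X Q.X R.X).hom) ⊗ₘ S.p =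
        (((P.p ⊗ₘ Q.p) ⊗ₘ R.p) ⊗ₘ S.p) ≫ ((α_ P.X Q.X R.X).hom ▷ S.X) := by
      rw [← tensorHom_id, tensorHom_comp_tensorHom, Category.comp_id]
    have e2 : P.p ⊗ₘ (((Q.p ⊗ₘ R.p) ⊗ₘ S.p) ≫ (α_ Q.X R.X S.X).hom) =
        (P.p ⊗ₘ ((Q.p ⊗ₘ R.p) ⊗ₘ S.p)) ≫ (P.X ◁ (α_ Q.X R.X S.X).hom) := by
      rw [← id_tensorHom, tensorHom_comp_tensorHom, Category.comp_id]
    have e3 : ((α_ P.X Q.X R.X).hom ▷ S.X) ≫ ((P.p ⊗ₘ (Q.p ⊗ₘ R.p)) ⊗ₘ S.p) =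
        (((P.p ⊗ₘ Q.p) ⊗ₘ R.p) ⊗ₘ S.p) ≫ ((α_ P.X Q.X R.X).hom ▷ S.X) := by
      rw [← tensorHom_id, tensorHom_comp_tensorHom, tensorHom_comp_tensorHom,
        associator_naturality, Category.comp_id, Category.id_comp]
    rw [e1, e2]
    simp only [Category.assoc]
    change (((P.p ⊗ₘ Q.p) ⊗ₘ R.p) ⊗ₘ S.p) ≫ (α_ P.X Q.X R.X).hom ▷ S.X ≫
      ((P.p ⊗ₘ Q.p ⊗ₘ R.p) ⊗ₘ S.p) ≫ (α_ P.X (Q.X ⊗ R.X) S.X).hom ≫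
        (P.p ⊗ₘ (Q.p ⊗ₘ R.p) ⊗ₘ S.p) ≫ P.X ◁ (α_ Q.X R.X S.X).hom =
      (((P.p ⊗ₘ Q.p) ⊗ₘ R.p) ⊗ₘ S.p) ≫ (α_ (P.X ⊗ Q.X) R.X S.X).hom ≫
        ((P.p ⊗ₘ Q.p) ⊗ₘ R.p ⊗ₘ S.p) ≫ (α_ P.X Q.X (R.X ⊗ S.X)).hom
    rw [← associator_naturality_assoc, ← associator_naturality_assoc, reassoc_of% e3,
      reassoc_of% e3, MonoidalCategory.pentagon]
    simp only [← Category.assoc, tensorHom_comp_tensorHom, Karoubi.idem])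
  (triangle := fun P Q => by
    apply Karoubi.hom_ext
    simp only [Karoubi.comp_f, karoubi_tensorHom_f, karoubi_associator_f, Category.assoc,
      Karoubi.id_f, karoubi_leftUnitor_f, karoubi_rightUnitor_f]
    change ((P.p ⊗ₘ 𝟙 (𝟙_ C)) ⊗ₘ Q.p) ≫ (α_ P.X (𝟙_ C) Q.X).hom ≫ _ = _
    have e1 : P.p ⊗ₘ ((𝟙 (𝟙_ C) ⊗ₘ Q.p) ≫ (λ_ Q.X).hom) =
        (P.p ⊗ₘ (𝟙 (𝟙_ C) ⊗ₘ Q.p)) ≫ (P.X ◁ (λ_ Q.X).hom) := by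
      rw [← id_tensorHom, tensorHom_comp_tensorHom, Category.comp_id]
    have e2 : ((P.p ⊗ₘ 𝟙 (𝟙_ C)) ≫ (ρ_ P.X).hom) ⊗ₘ Q.p =
        ((P.p ⊗ₘ 𝟙 (𝟙_ C)) ⊗ₘ Q.p) ≫ ((ρ_ P.X).hom ▷ Q.X) := by
      rw [← tensorHom_id, tensorHom_comp_tensorHom, Category.comp_id]
    rw [e1, e2, ← associator_naturality_assoc, MonoidalCategory.triangle]
    simp only [← Category.assoc, tensorHom_comp_tensorHom, Karoubi.idem, Category.comp_id])

theorem karoubi_whiskerLeft_f (P : Karoubi C) {Q R : Karoubi C} (f : Q ⟶ R) :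
    (P ◁ f).f = P.p ⊗ₘ f.f := rfl

theorem karoubi_whiskerRight_f {Q R : Karoubi C} (f : Q ⟶ R) (P : Karoubi C) :
    (f ▷ P).f = f.f ⊗ₘ P.p := rfl

instance [Preadditive C] [MonoidalPreadditive C] : MonoidalPreadditive (Karoubi C) where
  whiskerLeft_zero := Karoubi.hom_ext _ _ (MonoidalPreadditive.tensor_zero _)
  zero_whiskerRight := Karoubi.hom_ext _ _ (MonoidalPreadditive.zero_tensor _)
  whiskerLeft_add _ _ := Karoubi.hom_ext _ _ (MonoidalPreadditive.tensor_add _ _ _)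
  add_whiskerRight _ _ := Karoubi.hom_ext _ _ (MonoidalPreadditive.add_tensor _ _ _)

instance {K : Type w} [Field K] [Preadditive C] [MonoidalPreadditive C] [Linear K C]
    [MonoidalLinear K C] : MonoidalLinear K (Karoubi C) where
  whiskerLeft_smul X _ _ c f := Karoubi.hom_ext _ _ (by
    simp [karoubi_whiskerLeft_f, MonoidalCategory.tensorHom_def])
  smul_whiskerRight c _ _ f X := Karoubi.hom_ext _ _ (by
    simp [karoubi_whiskerRight_f, MonoidalCategory.tensorHom_def])

variable [SymmetricCategory C]

/-- The symmetry of the Karoubi envelope. -/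
def karoubiBraiding (P Q : Karoubi C) : P ⊗ Q ≅ Q ⊗ P :=
  karoubiIso (P := karoubiTensorObj P Q) (Q := karoubiTensorObj Q P) (β_ P.X Q.X)
    (BraidedCategory.braiding_naturality _ _)

theorem karoubiBraiding_f (P Q : Karoubi C) :
    (karoubiBraiding P Q).hom.f = (P.p ⊗ₘ Q.p) ≫ (β_ P.X Q.X).hom := rfl

theorem karoubiBraiding_natural {P Q P' Q' : Karoubi C} (f : P ⟶ Q) (g : P' ⟶ Q') :
    (f ⊗ₘ g) ≫ (karoubiBraiding Q Q').hom = (karoubiBraiding P P').hom ≫ (g ⊗ₘ f) := by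
  apply Karoubi.hom_ext
  simp only [Karoubi.comp_f, karoubi_tensorHom_f, karoubiBraiding_f, Category.assoc]
  rw [← BraidedCategory.braiding_naturality]
  simp only [← Category.assoc, tensorHom_comp_tensorHom, Karoubi.comp_p, Karoubi.p_comp]

instance : SymmetricCategory (Karoubi C) where
  braiding := karoubiBraiding
  braiding_naturality_right P _ _ f := karoubiBraiding_natural (𝟙 P) f
  braiding_naturality_left f P := karoubiBraiding_natural f (𝟙 P)
  hexagon_forward P Q R := by
    apply Karoubi.hom_ext
    simp only [Karoubi.comp_f, karoubi_whiskerLeft_f, karoubi_whiskerRight_f,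
      karoubi_associator_f, karoubiBraiding_f, Category.assoc]
    have e1 : ((P.p ⊗ₘ Q.p) ≫ (β_ P.X Q.X).hom) ⊗ₘ R.p =
        ((P.p ⊗ₘ Q.p) ⊗ₘ R.p) ≫ ((β_ P.X Q.X).hom ▷ R.X) := by
      rw [← tensorHom_id, tensorHom_comp_tensorHom, Category.comp_id]
    have e2 : Q.p ⊗ₘ ((P.p ⊗ₘ R.p) ≫ (β_ P.X R.X).hom) =
        (Q.p ⊗ₘ (P.p ⊗ₘ R.p)) ≫ (Q.X ◁ (β_ P.X R.X).hom) := by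
      rw [← id_tensorHom, tensorHom_comp_tensorHom, Category.comp_id]
    have e3 : ((β_ P.X Q.X).hom ▷ R.X) ≫ ((Q.p ⊗ₘ P.p) ⊗ₘ R.p) =
        ((P.p ⊗ₘ Q.p) ⊗ₘ R.p) ≫ ((β_ P.X Q.X).hom ▷ R.X) := by
      rw [← tensorHom_id, tensorHom_comp_tensorHom, tensorHom_comp_tensorHom,
        BraidedCategory.braiding_naturality, Category.comp_id, Category.id_comp]
    rw [e1, e2]
    simp only [Category.assoc]
    change ((P.p ⊗ₘ Q.p) ⊗ₘ R.p) ≫ (α_ P.X Q.X R.X).hom ≫ (P.p ⊗ₘ Q.p ⊗ₘ R.p) ≫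
        (β_ P.X (Q.X ⊗ R.X)).hom ≫ ((Q.p ⊗ₘ R.p) ⊗ₘ P.p) ≫ (α_ Q.X R.X P.X).hom =
      ((P.p ⊗ₘ Q.p) ⊗ₘ R.p) ≫ ((β_ P.X Q.X).hom ▷ R.X) ≫ ((Q.p ⊗ₘ P.p) ⊗ₘ R.p) ≫
        (α_ Q.X P.X R.X).hom ≫ (Q.p ⊗ₘ (P.p ⊗ₘ R.p)) ≫ (Q.X ◁ (β_ P.X R.X).hom)
    rw [← BraidedCategory.braiding_naturality_assoc, ← associator_naturality_assoc,
      ← associator_naturality_assoc, ← associator_naturality_assoc, reassoc_of% e3,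
      reassoc_of% e3, BraidedCategory.hexagon_forward]
  hexagon_reverse P Q R := by
    apply Karoubi.hom_ext
    simp only [Karoubi.comp_f, karoubi_whiskerLeft_f, karoubi_whiskerRight_f,
      karoubi_associator_inv_f, karoubiBraiding_f, Category.assoc]
    have e1 : ((P.p ⊗ₘ R.p) ≫ (β_ P.X R.X).hom) ⊗ₘ Q.p =
        ((P.p ⊗ₘ R.p) ⊗ₘ Q.p) ≫ ((β_ P.X R.X).hom ▷ Q.X) := by
      rw [← tensorHom_id, tensorHom_comp_tensorHom, Category.comp_id]
    have e2 : P.p ⊗ₘ ((Q.p ⊗ₘ R.p) ≫ (β_ Q.X R.X).hom) =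
        (P.p ⊗ₘ (Q.p ⊗ₘ R.p)) ≫ (P.X ◁ (β_ Q.X R.X).hom) := by
      rw [← id_tensorHom, tensorHom_comp_tensorHom, Category.comp_id]
    have e3 : (P.X ◁ (β_ Q.X R.X).hom) ≫ (P.p ⊗ₘ (R.p ⊗ₘ Q.p)) =
        (P.p ⊗ₘ (Q.p ⊗ₘ R.p)) ≫ (P.X ◁ (β_ Q.X R.X).hom) := by
      rw [← id_tensorHom, tensorHom_comp_tensorHom, tensorHom_comp_tensorHom,
        BraidedCategory.braiding_naturality, Category.comp_id, Category.id_comp]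
    rw [e1, e2]
    simp only [Category.assoc]
    change (α_ P.X Q.X R.X).inv ≫ ((P.p ⊗ₘ Q.p) ⊗ₘ R.p) ≫ ((P.p ⊗ₘ Q.p) ⊗ₘ R.p) ≫
        (β_ (P.X ⊗ Q.X) R.X).hom ≫ (α_ R.X P.X Q.X).inv ≫ ((R.p ⊗ₘ P.p) ⊗ₘ Q.p) =
      (P.p ⊗ₘ (Q.p ⊗ₘ R.p)) ≫ (P.X ◁ (β_ Q.X R.X).hom) ≫ (α_ P.X R.X Q.X).inv ≫
        ((P.p ⊗ₘ R.p) ⊗ₘ Q.p) ≫ ((P.p ⊗ₘ R.p) ⊗ₘ Q.p) ≫ ((β_ P.X R.X).hom ▷ Q.X)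
    rw [← associator_inv_naturality, ← BraidedCategory.braiding_naturality_assoc,
      ← associator_inv_naturality_assoc, ← associator_inv_naturality_assoc,
      ← associator_inv_naturality_assoc, ← associator_inv_naturality_assoc,
      ← associator_inv_naturality_assoc, reassoc_of% e3,
      reassoc_of% e3, BraidedCategory.hexagon_reverse]
  symmetry P Q := by
    apply Karoubi.hom_ext
    simp only [Karoubi.comp_f, karoubiBraiding_f, Category.assoc]
    rw [← BraidedCategory.braiding_naturality_assoc, SymmetricCategory.symmetry]
    simp only [tensorHom_comp_tensorHom, Karoubi.idem, Category.comp_id]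
    rfl

end KaroubiTensor

end DeligneKnop

end

noncomputable section

namespace DeligneKnop

open CategoryTheory CategoryTheory.Limits MonoidalCategory CategoryTheory.Idempotents

universe v u v' u' w

section MatFunctor

variable {C : Type u} [Category.{v} C] [Preadditive C] {D : Type u'} [Category.{v'} D]
  [Preadditive D] (F : C ⥤ D) [F.Additive]

/-- The image of a tuple of objects under a functor. -/
abbrev mapMatObj (M : Mat_ C) : Mat_ D := ⟨M.ι, fun i => F.obj (M.X i)⟩

/-- The image of a matrix under a functor. -/
def mapMatHom {M N : Mat_ C} (f : M ⟶ N) : mapMatObj F M ⟶ mapMatObj F N :=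
  fun i j => F.map (f i j)

theorem mapMatHom_apply {M N : Mat_ C} (f : M ⟶ N) (i : M.ι) (j : N.ι) :
    mapMatHom F f i j = F.map (f i j) := rfl

theorem mapMatHom_reindex {M N : Mat_ C} (e : M.ι → N.ι) (φ : ∀ i, M.X i ⟶ N.X (e i)) :
    mapMatHom F (reindex e φ) =
      reindex (M := mapMatObj F M) (N := mapMatObj F N) e (fun i => F.map (φ i)) := by
  ext i j
  rw [mapMatHom_apply]
  by_cases h : e i = j
  · subst h
    rw [reindex_apply_self]
    exact (reindex_apply_self (M := mapMatObj F M) (N := mapMatObj F N) e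
      (fun i => F.map (φ i)) i).symm
  · rw [reindex_apply_of_ne h, F.map_zero]
    exact (reindex_apply_of_ne (M := mapMatObj F M) (N := mapMatObj F N) h).symm

theorem mapMatHom_id (M : Mat_ C) : mapMatHom F (𝟙 M) = 𝟙 (mapMatObj F M) := by
  rw [id_eq_reindex, id_eq_reindex, mapMatHom_reindex]
  exact congrArg (reindex (M := mapMatObj F M) (N := mapMatObj F M) id)
    (funext fun i => F.map_id _)

/-- The functor `Mat_ C ⥤ Mat_ D` induced by an additive functor. -/
def mapMat : Mat_ C ⥤ Mat_ D where
  obj M := mapMatObj F M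
  map f := mapMatHom F f
  map_id M := mapMatHom_id F M
  map_comp {M N P} f g := by
    ext i k
    rw [mapMatHom_apply, Mat_.comp_apply, Mat_.comp_apply, F.map_sum]
    exact Finset.sum_congr rfl fun j _ => F.map_comp _ _

instance : (mapMat F).Additive where
  map_add {_ _ _ _} := Mat_.hom_ext _ _ fun _ _ => F.map_add

instance {K : Type w} [Field K] [Linear K C] [Linear K D] [F.Linear K] :
    (mapMat F).Linear K where
  map_smul {_ _} f c := Mat_.hom_ext _ _ fun i j => Functor.Linear.map_smul (F := F) (f i j) c

variable [MonoidalCategory C] [MonoidalCategory D]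

open Functor.LaxMonoidal Functor.Monoidal

/-- The comparison between the unit objects of `Mat_ D` and `Mat_ C`. -/
def matEpsIso [F.Monoidal] :
    (⟨PUnit, fun _ => 𝟙_ D⟩ : Mat_ D) ≅ mapMatObj F (⟨PUnit, fun _ => 𝟙_ C⟩ : Mat_ C) where
  hom := reindex (M := ⟨PUnit, fun _ => 𝟙_ D⟩) (N := mapMatObj F ⟨PUnit, fun _ => 𝟙_ C⟩) id
    (fun _ => (εIso F).hom)
  inv := reindex (M := mapMatObj F ⟨PUnit, fun _ => 𝟙_ C⟩) (N := ⟨PUnit, fun _ => 𝟙_ D⟩) id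
    (fun _ => (εIso F).inv)
  hom_inv_id := by
    rw [reindex_comp_reindex, id_eq_reindex]
    exact congrArg (reindex (M := ⟨PUnit, fun _ => 𝟙_ D⟩) (N := ⟨PUnit, fun _ => 𝟙_ D⟩) id)
      (funext fun _ => Iso.hom_inv_id _)
  inv_hom_id := by
    rw [reindex_comp_reindex, id_eq_reindex]
    exact congrArg (reindex (M := mapMatObj F ⟨PUnit, fun _ => 𝟙_ C⟩)
      (N := mapMatObj F ⟨PUnit, fun _ => 𝟙_ C⟩) id) (funext fun _ => Iso.inv_hom_id _)

/-- The comparison between tensor products in `Mat_ D` and in `Mat_ C`. -/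
def matMuIso [F.Monoidal] (X Y : Mat_ C) :
    matTensorObj (mapMatObj F X) (mapMatObj F Y) ≅ mapMatObj F (matTensorObj X Y) where
  hom := reindex (M := matTensorObj (mapMatObj F X) (mapMatObj F Y))
    (N := mapMatObj F (matTensorObj X Y)) id (fun i => (μIso F (X.X i.1) (Y.X i.2)).hom)
  inv := reindex (M := mapMatObj F (matTensorObj X Y))
    (N := matTensorObj (mapMatObj F X) (mapMatObj F Y)) id
    (fun i => (μIso F (X.X i.1) (Y.X i.2)).inv)
  hom_inv_id := by
    rw [reindex_comp_reindex, id_eq_reindex]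
    exact congrArg (reindex (M := matTensorObj (mapMatObj F X) (mapMatObj F Y))
      (N := matTensorObj (mapMatObj F X) (mapMatObj F Y)) id) (funext fun _ => Iso.hom_inv_id _)
  inv_hom_id := by
    rw [reindex_comp_reindex, id_eq_reindex]
    exact congrArg (reindex (M := mapMatObj F (matTensorObj X Y))
      (N := mapMatObj F (matTensorObj X Y)) id) (funext fun _ => Iso.inv_hom_id _)

theorem matMuIso_natural [F.Monoidal] {X Y X' Y' : Mat_ C} (f : X ⟶ Y) (g : X' ⟶ Y') :
    matTensorHom (mapMatHom F f) (mapMatHom F g) ≫ (matMuIso F Y Y').hom =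
      (matMuIso F X X').hom ≫ mapMatHom F (matTensorHom f g) :=
  reindex_natural _ _ _ _ _ _ Function.bijective_id fun _ _ => μ_natural F _ _

variable [MonoidalPreadditive C] [MonoidalPreadditive D]

/-- `mapMat F` is monoidal if `F` is, with structure isomorphisms those of `F` on summands. -/
def mapMatCore [F.Monoidal] : (mapMat F).CoreMonoidal where
  εIso := matEpsIso F
  μIso X Y := matMuIso F X Y
  μIso_hom_natural_left {X Y} f Z := by
    have := matMuIso_natural F f (𝟙 Z)
    rw [mapMatHom_id] at this
    exact this
  μIso_hom_natural_right {X Y} Z f := by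
    have := matMuIso_natural F (𝟙 Z) f
    rw [mapMatHom_id] at this
    exact this
  associativity X Y Z := by
    have : matTensorHom (matMuIso F X Y).hom (𝟙 (mapMatObj F Z)) ≫
        (matMuIso F (matTensorObj X Y) Z).hom ≫ mapMatHom F
          (reindex (M := matTensorObj (matTensorObj X Y) Z)
            (N := matTensorObj X (matTensorObj Y Z)) (fun i => (i.1.1, (i.1.2, i.2)))
            (fun i => (α_ (X.X i.1.1) (Y.X i.1.2) (Z.X i.2)).hom)) =
        reindex (M := matTensorObj (matTensorObj (mapMatObj F X) (mapMatObj F Y)) (mapMatObj F Z))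
            (N := matTensorObj (mapMatObj F X) (matTensorObj (mapMatObj F Y) (mapMatObj F Z)))
            (fun i => (i.1.1, (i.1.2, i.2)))
            (fun i => (α_ (F.obj (X.X i.1.1)) (F.obj (Y.X i.1.2)) (F.obj (Z.X i.2))).hom) ≫
          matTensorHom (𝟙 (mapMatObj F X)) (matMuIso F Y Z).hom ≫
            (matMuIso F X (matTensorObj Y Z)).hom := by
      rw [matMuIso, matMuIso, matMuIso, matMuIso, id_eq_reindex, id_eq_reindex,
        matTensorHom_reindex, matTensorHom_reindex, mapMatHom_reindex, reindex_comp_reindex,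
        reindex_comp_reindex, reindex_comp_reindex, reindex_comp_reindex]
      refine congrArg (reindex (M := matTensorObj (matTensorObj (mapMatObj F X) (mapMatObj F Y))
        (mapMatObj F Z)) (N := mapMatObj F (matTensorObj X (matTensorObj Y Z)))
        (fun i => (i.1.1, (i.1.2, i.2)))) (funext fun i => ?_)
      rw [tensorHom_id, id_tensorHom]
      exact Functor.LaxMonoidal.associativity F _ _ _
    exact this
  left_unitality X := by
    have : reindex (M := matTensorObj ⟨PUnit, fun _ => 𝟙_ D⟩ (mapMatObj F X)) (N := mapMatObj F X)
          (fun i => i.2) (fun i => (λ_ (F.obj (X.X i.2))).hom) =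
        matTensorHom (matEpsIso F).hom (𝟙 (mapMatObj F X)) ≫
          (matMuIso F ⟨PUnit, fun _ => 𝟙_ C⟩ X).hom ≫ mapMatHom F
            (reindex (M := matTensorObj ⟨PUnit, fun _ => 𝟙_ C⟩ X) (N := X) (fun i => i.2)
              (fun i => (λ_ (X.X i.2)).hom)) := by
      rw [matMuIso, matEpsIso, id_eq_reindex, matTensorHom_reindex, mapMatHom_reindex,
        reindex_comp_reindex, reindex_comp_reindex]
      refine congrArg (reindex (M := matTensorObj ⟨PUnit, fun _ => 𝟙_ D⟩ (mapMatObj F X))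
        (N := mapMatObj F X) (fun i => i.2)) (funext fun i => ?_)
      rw [tensorHom_id]
      exact Functor.LaxMonoidal.left_unitality F _
    exact this
  right_unitality X := by
    have : reindex (M := matTensorObj (mapMatObj F X) ⟨PUnit, fun _ => 𝟙_ D⟩) (N := mapMatObj F X)
          (fun i => i.1) (fun i => (ρ_ (F.obj (X.X i.1))).hom) =
        matTensorHom (𝟙 (mapMatObj F X)) (matEpsIso F).hom ≫
          (matMuIso F X ⟨PUnit, fun _ => 𝟙_ C⟩).hom ≫ mapMatHom F
            (reindex (M := matTensorObj X ⟨PUnit, fun _ => 𝟙_ C⟩) (N := X) (fun i => i.1)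
              (fun i => (ρ_ (X.X i.1)).hom)) := by
      rw [matMuIso, matEpsIso, id_eq_reindex, matTensorHom_reindex, mapMatHom_reindex,
        reindex_comp_reindex, reindex_comp_reindex]
      refine congrArg (reindex (M := matTensorObj (mapMatObj F X) ⟨PUnit, fun _ => 𝟙_ D⟩)
        (N := mapMatObj F X) (fun i => i.1)) (funext fun i => ?_)
      rw [id_tensorHom]
      exact Functor.LaxMonoidal.right_unitality F _
    exact this

instance [F.Monoidal] : (mapMat F).Monoidal := (mapMatCore F).toMonoidal

instance [SymmetricCategory C] [SymmetricCategory D] [F.Braided] : (mapMat F).Braided where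
  braided X Y := by
    have : (matMuIso F X Y).hom ≫ mapMatHom F (matBraiding X Y) =
        matBraiding (mapMatObj F X) (mapMatObj F Y) ≫ (matMuIso F Y X).hom := by
      rw [matMuIso, matMuIso, matBraiding, matBraiding, mapMatHom_reindex, reindex_comp_reindex,
        reindex_comp_reindex]
      exact congrArg (reindex (M := matTensorObj (mapMatObj F X) (mapMatObj F Y))
        (N := mapMatObj F (matTensorObj Y X)) (fun i => (i.2, i.1)))
        (funext fun i => Functor.LaxBraided.braided _ _)
    exact this

end MatFunctor

section KaroubiFunctor

variable {C : Type u} [Category.{v} C] {D : Type u'} [Category.{v'} D] (F : C ⥤ D)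

/-- The functor `Karoubi C ⥤ Karoubi D` induced by a functor: `(X, p) ↦ (F X, F p)`. -/
def mapKaroubi : Karoubi C ⥤ Karoubi D where
  obj P := ⟨F.obj P.X, F.map P.p, by rw [← F.map_comp, P.idem]⟩
  map f := ⟨F.map f.f, (by rw [F.map_comp, F.map_comp] :
    F.map _ ≫ F.map _ ≫ F.map _ = F.map (_ ≫ _ ≫ _)).trans (congrArg F.map f.comm)⟩
  map_id _ := rfl
  map_comp f g := by
    apply Karoubi.hom_ext
    exact F.map_comp _ _

theorem mapKaroubi_map_f {P Q : Karoubi C} (f : P ⟶ Q) :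
    ((mapKaroubi F).map f).f = F.map f.f := rfl

instance [Preadditive C] [Preadditive D] [F.Additive] : (mapKaroubi F).Additive where
  map_add {_ _ _ _} := by
    apply Karoubi.hom_ext
    exact F.map_add

instance {K : Type w} [Field K] [Preadditive C] [Preadditive D] [F.Additive] [Linear K C]
    [Linear K D] [F.Linear K] : (mapKaroubi F).Linear K where
  map_smul f c := by
    apply Karoubi.hom_ext
    exact Functor.Linear.map_smul (F := F) f.f c

variable [MonoidalCategory C] [MonoidalCategory D]

open Functor.LaxMonoidal Functor.Monoidal

/-- `mapKaroubi F` is monoidal if `F` is. -/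
def mapKaroubiCore [F.Monoidal] : (mapKaroubi F).CoreMonoidal where
  εIso := karoubiIso (P := 𝟙_ (Karoubi D)) (Q := (mapKaroubi F).obj (𝟙_ (Karoubi C))) (εIso F) (by
    change 𝟙 _ ≫ _ = _ ≫ F.map (𝟙 _)
    simp)
  μIso P Q := karoubiIso (P := (mapKaroubi F).obj P ⊗ (mapKaroubi F).obj Q)
    (Q := (mapKaroubi F).obj (P ⊗ Q)) (μIso F P.X Q.X) (μ_natural F P.p Q.p)
  μIso_hom_natural_left {P Q} f R := by
    apply Karoubi.hom_ext
    change (F.map f.f ⊗ₘ F.map R.p) ≫ (F.map Q.p ⊗ₘ F.map R.p) ≫ μ F Q.X R.X =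
      ((F.map P.p ⊗ₘ F.map R.p) ≫ μ F P.X R.X) ≫ F.map (f.f ⊗ₘ R.p)
    rw [Category.assoc, ← μ_natural, tensorHom_comp_tensorHom_assoc,
      tensorHom_comp_tensorHom_assoc]
    simp only [← F.map_comp, Karoubi.comp_p, Karoubi.p_comp]
  μIso_hom_natural_right {P Q} R f := by
    apply Karoubi.hom_ext
    change (F.map R.p ⊗ₘ F.map f.f) ≫ (F.map R.p ⊗ₘ F.map Q.p) ≫ μ F R.X Q.X =
      ((F.map R.p ⊗ₘ F.map P.p) ≫ μ F R.X P.X) ≫ F.map (R.p ⊗ₘ f.f)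
    rw [Category.assoc, ← μ_natural, tensorHom_comp_tensorHom_assoc,
      tensorHom_comp_tensorHom_assoc]
    simp only [← F.map_comp, Karoubi.comp_p, Karoubi.p_comp]
  associativity P Q R := by
    apply Karoubi.hom_ext
    change (((F.map P.p ⊗ₘ F.map Q.p) ≫ μ F P.X Q.X) ⊗ₘ F.map R.p) ≫
        ((F.map (P.p ⊗ₘ Q.p) ⊗ₘ F.map R.p) ≫ μ F (P.X ⊗ Q.X) R.X) ≫
          F.map (((P.p ⊗ₘ Q.p) ⊗ₘ R.p) ≫ (α_ P.X Q.X R.X).hom) =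
      (((F.map P.p ⊗ₘ F.map Q.p) ⊗ₘ F.map R.p) ≫ (α_ _ _ _).hom) ≫
        (F.map P.p ⊗ₘ ((F.map Q.p ⊗ₘ F.map R.p) ≫ μ F Q.X R.X)) ≫
          (F.map P.p ⊗ₘ F.map (Q.p ⊗ₘ R.p)) ≫ μ F P.X (Q.X ⊗ R.X)
    have e1 : ((F.map P.p ⊗ₘ F.map Q.p) ≫ μ F P.X Q.X) ⊗ₘ F.map R.p =
        ((F.map P.p ⊗ₘ F.map Q.p) ⊗ₘ F.map R.p) ≫ μ F P.X Q.X ▷ F.obj R.X := by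
      rw [← tensorHom_id, tensorHom_comp_tensorHom, Category.comp_id]
    have e2 : F.map P.p ⊗ₘ ((F.map Q.p ⊗ₘ F.map R.p) ≫ μ F Q.X R.X) =
        (F.map P.p ⊗ₘ (F.map Q.p ⊗ₘ F.map R.p)) ≫ (F.obj P.X ◁ μ F Q.X R.X) := by
      rw [← id_tensorHom, tensorHom_comp_tensorHom, Category.comp_id]
    have e3 : μ F P.X Q.X ▷ F.obj R.X ≫ (F.map (P.p ⊗ₘ Q.p) ⊗ₘ F.map R.p) =
        ((F.map P.p ⊗ₘ F.map Q.p) ⊗ₘ F.map R.p) ≫ μ F P.X Q.X ▷ F.obj R.X := by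
      rw [← tensorHom_id, tensorHom_comp_tensorHom, tensorHom_comp_tensorHom, Category.comp_id,
        Category.id_comp, μ_natural]
    have e4 : (F.obj P.X ◁ μ F Q.X R.X) ≫ (F.map P.p ⊗ₘ F.map (Q.p ⊗ₘ R.p)) =
        (F.map P.p ⊗ₘ (F.map Q.p ⊗ₘ F.map R.p)) ≫ (F.obj P.X ◁ μ F Q.X R.X) := by
      rw [← id_tensorHom, tensorHom_comp_tensorHom, tensorHom_comp_tensorHom, Category.comp_id,
        Category.id_comp, μ_natural]
    have e5 : ((F.map P.p ⊗ₘ F.map Q.p) ⊗ₘ F.map R.p) ≫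
        ((F.map P.p ⊗ₘ F.map Q.p) ⊗ₘ F.map R.p) = (F.map P.p ⊗ₘ F.map Q.p) ⊗ₘ F.map R.p := by
      simp only [tensorHom_comp_tensorHom, ← F.map_comp, Karoubi.idem]
    have e6 : (F.map P.p ⊗ₘ (F.map Q.p ⊗ₘ F.map R.p)) ≫
        (F.map P.p ⊗ₘ (F.map Q.p ⊗ₘ F.map R.p)) = F.map P.p ⊗ₘ (F.map Q.p ⊗ₘ F.map R.p) := by
      simp only [tensorHom_comp_tensorHom, ← F.map_comp, Karoubi.idem]
    rw [e1, e2]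
    simp only [Category.assoc, F.map_comp]
    rw [← μ_natural_assoc, reassoc_of% e3, reassoc_of% e3, reassoc_of% e5, reassoc_of% e5,
      reassoc_of% e4, reassoc_of% e6, ← associator_naturality_assoc, reassoc_of% e5,
      Functor.LaxMonoidal.associativity]
  left_unitality P := by
    apply Karoubi.hom_ext
    change (𝟙 (𝟙_ D) ⊗ₘ F.map P.p) ≫ (λ_ (F.obj P.X)).hom =
      ((𝟙 (𝟙_ D) ≫ ε F) ⊗ₘ F.map P.p) ≫ ((F.map (𝟙 (𝟙_ C)) ⊗ₘ F.map P.p) ≫ μ F (𝟙_ C) P.X) ≫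
        F.map ((𝟙 (𝟙_ C) ⊗ₘ P.p) ≫ (λ_ P.X).hom)
    rw [Functor.LaxMonoidal.left_unitality]
    simp only [Category.assoc, F.map_comp, Category.id_comp]
    rw [← μ_natural_assoc, tensorHom_comp_tensorHom_assoc, tensorHom_comp_tensorHom_assoc,
      ← tensorHom_id, tensorHom_comp_tensorHom_assoc]
    simp only [← F.map_comp, Karoubi.idem, F.map_id, Category.comp_id, Category.id_comp]
  right_unitality P := by
    apply Karoubi.hom_ext
    change (F.map P.p ⊗ₘ 𝟙 (𝟙_ D)) ≫ (ρ_ (F.obj P.X)).hom =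
      (F.map P.p ⊗ₘ (𝟙 (𝟙_ D) ≫ ε F)) ≫ ((F.map P.p ⊗ₘ F.map (𝟙 (𝟙_ C))) ≫ μ F P.X (𝟙_ C)) ≫
        F.map ((P.p ⊗ₘ 𝟙 (𝟙_ C)) ≫ (ρ_ P.X).hom)
    rw [Functor.LaxMonoidal.right_unitality]
    simp only [Category.assoc, F.map_comp, Category.id_comp]
    rw [← μ_natural_assoc, tensorHom_comp_tensorHom_assoc, tensorHom_comp_tensorHom_assoc,
      ← id_tensorHom, tensorHom_comp_tensorHom_assoc]
    simp only [← F.map_comp, Karoubi.idem, F.map_id, Category.comp_id, Category.id_comp]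

instance [F.Monoidal] : (mapKaroubi F).Monoidal := (mapKaroubiCore F).toMonoidal

instance [SymmetricCategory C] [SymmetricCategory D] [F.Braided] : (mapKaroubi F).Braided where
  braided P Q := by
    apply Karoubi.hom_ext
    change ((F.map P.p ⊗ₘ F.map Q.p) ≫ μ F P.X Q.X) ≫ F.map ((P.p ⊗ₘ Q.p) ≫ (β_ P.X Q.X).hom) =
      ((F.map P.p ⊗ₘ F.map Q.p) ≫ (β_ (F.obj P.X) (F.obj Q.X)).hom) ≫
        (F.map Q.p ⊗ₘ F.map P.p) ≫ μ F Q.X P.X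
    simp only [Category.assoc, F.map_comp]
    rw [← μ_natural_assoc, ← BraidedCategory.braiding_naturality_assoc,
      Functor.LaxBraided.braided]

end KaroubiFunctor

section Induced

variable {K : Type w} [Field K] {A : Type u} [Category.{v} A] {A' : Type u'} [Category.{v'} A']
  [RegularCat A] [RegularCat A'] {F : A ⥤ A'} {δ : DegreeFunction K A}
  {δ' : DegreeFunction K A'} (hp : PreservesPullbacks F) (hd : PreservesDegree F δ δ')

/-- The category `𝒯(A, δ)`: the additive Karoubi envelope of `𝒯⁰(A, δ)`. -/
abbrev DeligneKnopCat (δ : DegreeFunction K A) := Karoubi (Mat_ (Skeletal δ))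

/-- The functor `𝒯(A, δ) ⥤ 𝒯(A', δ')` induced by a functor `A ⥤ A'` which preserves pullbacks and
degrees. -/
def inducedFunctor : DeligneKnopCat δ ⥤ DeligneKnopCat δ' :=
  mapKaroubi (mapMat (skeletalFunctor hp hd))

instance : (inducedFunctor hp hd).Additive :=
  inferInstanceAs (mapKaroubi (mapMat (skeletalFunctor hp hd))).Additive

instance : (inducedFunctor hp hd).Linear K :=
  inferInstanceAs ((mapKaroubi (mapMat (skeletalFunctor hp hd))).Linear K)

theorem skeletalFunctor_graph {X Y : Skeletal δ} (f : X.obj ⟶ Y.obj) :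
    (skeletalFunctor hp hd).map (Skeletal.graph f) = Skeletal.graph (F.map f) :=
  (skeletalFunctor_span hp hd _ _).trans (congrArg (fun k => Skeletal.span k _) (F.map_id _))

variable [CartesianMonoidalCategory A] [CartesianMonoidalCategory A']

open Functor.LaxMonoidal Functor.Monoidal

/-- If `F` preserves finite products, the functor induced on `𝒯⁰` is monoidal. The structure
isomorphisms are the graphs of the canonical isomorphisms `F x × F y ≅ F (x × y)`. -/
def skeletalCore [F.Monoidal] : (skeletalFunctor hp hd).CoreMonoidal where
  εIso := Skeletal.graphIso (X := 𝟙_ (Skeletal δ')) (εIso F)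
  μIso X Y := Skeletal.graphIso (X := (skeletalFunctor hp hd).obj X ⊗ (skeletalFunctor hp hd).obj Y)
    (Y := (skeletalFunctor hp hd).obj (X ⊗ Y)) (μIso F X.obj Y.obj)
  μIso_hom_natural_left {X Y} f Z := by
    induction f using Skeletal.induction with
    | zero => simp
    | add f g hf hg => simp [hf, hg, Functor.map_add]
    | smul c f hf => simp [hf, Functor.map_smul]
    | span a b =>
    have e1 : (skeletalFunctor hp hd).map (Skeletal.span a b) ▷ (skeletalFunctor hp hd).obj Z = _ :=
      (congrArg (fun k => k ▷ (skeletalFunctor hp hd).obj Z) (skeletalFunctor_span hp hd a b)).trans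
        (Skeletal.span_whiskerRight (F.map a) (F.map b) _)
    have e2 : (skeletalFunctor hp hd).map (Skeletal.span a b ▷ Z) = _ :=
      (congrArg (skeletalFunctor hp hd).map (Skeletal.span_whiskerRight a b Z)).trans
        (skeletalFunctor_span hp hd _ _)
    rw [e1, e2]
    exact Skeletal.span_comp_graphIso_iff _ _ _ _ (μIso F _ _) (μIso F _ _) (μIso F _ _)
      (μ_natural_left F _ _) (μ_natural_left F _ _)
  μIso_hom_natural_right {X Y} Z f := by
    induction f using Skeletal.induction with
    | zero => simp
    | add f g hf hg => simp [hf, hg, Functor.map_add]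
    | smul c f hf => simp [hf, Functor.map_smul]
    | span a b =>
    have e1 : (skeletalFunctor hp hd).obj Z ◁ (skeletalFunctor hp hd).map (Skeletal.span a b) = _ :=
      (congrArg (fun k => (skeletalFunctor hp hd).obj Z ◁ k) (skeletalFunctor_span hp hd a b)).trans
        (Skeletal.span_whiskerLeft _ (F.map a) (F.map b))
    have e2 : (skeletalFunctor hp hd).map (Z ◁ Skeletal.span a b) = _ :=
      (congrArg (skeletalFunctor hp hd).map (Skeletal.span_whiskerLeft Z a b)).trans
        (skeletalFunctor_span hp hd _ _)
    rw [e1, e2]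
    exact Skeletal.span_comp_graphIso_iff _ _ _ _ (μIso F _ _) (μIso F _ _) (μIso F _ _)
      (μ_natural_right F _ _) (μ_natural_right F _ _)
  associativity X Y Z := by
    refine (congrArg₂ (· ≫ ·) (Skeletal.graph_whiskerRight (μ F X.obj Y.obj) _)
      ((congrArg _ (skeletalFunctor_graph hp hd _)).trans (Skeletal.graph_comp _ _).symm)).trans
      ((Skeletal.graph_comp _ _).symm.trans (Eq.trans ?_ (congrArg _
        ((Skeletal.graph_comp _ _).trans (congrArg (· ≫ _)
          (Skeletal.graph_whiskerLeft _ (μ F Y.obj Z.obj)).symm)))))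
    exact (congrArg Skeletal.graph (Functor.LaxMonoidal.associativity F _ _ _)).trans
      (Skeletal.graph_comp _ _)
  left_unitality X := by
    refine Eq.trans ?_ (congrArg₂ (· ≫ ·) (Skeletal.graph_whiskerRight (ε F) _)
      ((congrArg _ (skeletalFunctor_graph hp hd _)).trans (Skeletal.graph_comp _ _).symm)).symm
    exact (congrArg Skeletal.graph (Functor.LaxMonoidal.left_unitality F _)).trans
      (Skeletal.graph_comp _ _)
  right_unitality X := by
    refine Eq.trans ?_ (congrArg₂ (· ≫ ·) (Skeletal.graph_whiskerLeft _ (ε F))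
      ((congrArg _ (skeletalFunctor_graph hp hd _)).trans (Skeletal.graph_comp _ _).symm)).symm
    exact (congrArg Skeletal.graph (Functor.LaxMonoidal.right_unitality F _)).trans
      (Skeletal.graph_comp _ _)

instance [F.Monoidal] : (skeletalFunctor hp hd).Monoidal := (skeletalCore hp hd).toMonoidal

variable [BraidedCategory A] [BraidedCategory A']

instance [F.Braided] : (skeletalFunctor hp hd).Braided where
  braided X Y := by
    refine ((congrArg _ (skeletalFunctor_graph hp hd _)).trans (Skeletal.graph_comp _ _).symm).trans
      (Eq.trans ?_ (Skeletal.graph_comp _ _))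
    exact congrArg Skeletal.graph (Functor.LaxBraided.braided (F := F) X.obj Y.obj)

instance [F.Braided] : (inducedFunctor hp hd).Braided :=
  inferInstanceAs (mapKaroubi (mapMat (skeletalFunctor hp hd))).Braided

end Induced

end DeligneKnop

end

open CategoryTheory CategoryTheory.Limits

universe w₁ w₂ w v u v' u'

/-!
The adjunction `G ⊣ F` lifts to an adjunction between the induced functors, so that the functor
induced by `F` is a right adjoint and preserves limits.

On `𝒯⁰` the unit and the counit are the graphs of `η` and `ε`, and the triangle identities hold
because taking graphs is functorial. The point is naturality with respect to *relations*, where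
only naturality with respect to graphs is automatic. For a span `x' ← t → y'` with legs `a`, `b`,
the composite with the graph of `η` at `y'` is the span with legs `a` and `b ≫ η`, whereas the
composite of the graph of `η` at `x'` with `F G t` is computed by the fibre product of `x'` and
`F G t` over `F G x'`. The square of `η` at `a` being Cartesian, this fibre product is `t`, with
projections `a` and `η`, and both composites agree by the naturality of `η`; likewise for `ε`. This
is `Skeletal.span_comp_graph_eq`. An adjunction of additive functors then passes to categories of
matrices entrywise (`adjunctionMapMat`), and any adjunction passes to idempotent completions
(`adjunctionMapKaroubi`).

The functor induced by `F` is symmetric monoidal because `F`, a right adjoint, preserves finite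
products.
-/

namespace DeligneKnop

open CategoryTheory.Idempotents

/-- Morphisms `φ`, `ψ`, `χ` from the vertices of one span to those of another commute with the
relations the spans define, provided that the square of first legs is Cartesian. -/
theorem Skeletal.span_comp_graph_eq {K : Type w} [Field K] {A : Type u} [Category.{v} A]
    [RegularCat A] {δ : DegreeFunction K A} {X Y X' Y' : Skeletal δ} {t t' : A}
    {a : t ⟶ X.obj} {b : t ⟶ Y.obj} {a' : t' ⟶ X'.obj} {b' : t' ⟶ Y'.obj}
    {φ : X.obj ⟶ X'.obj} {ψ : Y.obj ⟶ Y'.obj} {χ : t ⟶ t'}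
    (ha : IsPullback a χ φ a') (hb : b ≫ ψ = χ ≫ b') :
    (Skeletal.span a b : X ⟶ Y) ≫ Skeletal.graph ψ =
      Skeletal.graph φ ≫ (Skeletal.span a' b' : X' ⟶ Y') := by
  rw [Skeletal.span_comp_graph, Skeletal.graph, Skeletal.span_comp ha, hb, Category.comp_id]

/-- An adjunction with Cartesian unit and counit extends from the regular categories to the
categories of relations; its unit and counit are the graphs of the given ones. -/
noncomputable def adjunctionSkeletal {K : Type w} [Field K] {A : Type u} [Category.{v} A]
    {A' : Type u'} [Category.{v'} A'] [RegularCat A] [RegularCat A'] {δ : DegreeFunction K A}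
    {δ' : DegreeFunction K A'} {F : A ⥤ A'} {G : A' ⥤ A} (adj : G ⊣ F)
    (hFp : PreservesPullbacks F) (hF : PreservesDegree F δ δ')
    (hGp : PreservesPullbacks G) (hG : PreservesDegree G δ' δ)
    (hη : ∀ {x' y' : A'} (f' : x' ⟶ y'),
      IsPullback (adj.unit.app x') f' (F.map (G.map f')) (adj.unit.app y'))
    (hε : ∀ {x y : A} (f : x ⟶ y),
      IsPullback (adj.counit.app x) (G.map (F.map f)) f (adj.counit.app y)) :
    skeletalFunctor hGp hG ⊣ skeletalFunctor hFp hF where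
  unit :=
    { app X := Skeletal.graph (adj.unit.app X.obj)
      naturality {X Y} f := by
        dsimp only [Functor.id_map, Functor.comp_map]
        induction f using Skeletal.induction with
        | zero => simp
        | add f g hf hg => simp [hf, hg, Functor.map_add]
        | smul c f hf => simp [hf, Functor.map_smul]
        | span a b =>
        rw [skeletalFunctor_span hGp hG]
        erw [skeletalFunctor_span hFp hF]
        exact Skeletal.span_comp_graph_eq (hη a).flip (adj.unit_naturality b).symm }
  counit :=
    { app X := Skeletal.graph (adj.counit.app X.obj)
      naturality {X Y} f := by
        dsimp only [Functor.id_map, Functor.comp_map]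
        induction f using Skeletal.induction with
        | zero => simp
        | add f g hf hg => simp [hf, hg, Functor.map_add]
        | smul c f hf => simp [hf, Functor.map_smul]
        | span a b =>
        rw [skeletalFunctor_span hFp hF]
        erw [skeletalFunctor_span hGp hG]
        exact Skeletal.span_comp_graph_eq (hε a).flip (adj.counit_naturality b) }
  left_triangle_components X := by
    refine (congrArg (· ≫ _) (skeletalFunctor_graph hGp hG _)).trans ?_
    refine (Skeletal.graph_comp _ _).symm.trans ?_
    exact congrArg Skeletal.graph (adj.left_triangle_components X.obj)
  right_triangle_components X := by
    refine (congrArg (_ ≫ ·) (skeletalFunctor_graph hFp hF _)).trans ?_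
    refine (Skeletal.graph_comp _ _).symm.trans ?_
    exact congrArg Skeletal.graph (adj.right_triangle_components X.obj)

/-- An adjunction of additive functors induces one of matrix categories, whose unit and counit are
diagonal matrices. -/
noncomputable def adjunctionMapMat {C : Type u} [Category.{v} C] [Preadditive C] {D : Type u'}
    [Category.{v'} D] [Preadditive D] {L : C ⥤ D} {R : D ⥤ C} [L.Additive] [R.Additive]
    (adj : L ⊣ R) : mapMat L ⊣ mapMat R where
  unit :=
    { app M := reindex (N := mapMatObj R (mapMatObj L M)) id (fun i => adj.unit.app (M.X i))
      naturality {M N} f := reindex_natural f (mapMatHom R (mapMatHom L f)) _ _ _ _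
        Function.bijective_id (fun i j => (adj.unit_naturality (f i j)).symm) }
  counit :=
    { app M := reindex (M := mapMatObj L (mapMatObj R M)) id (fun i => adj.counit.app (M.X i))
      naturality {M N} f := reindex_natural (mapMatHom L (mapMatHom R f)) f _ _ _ _
        Function.bijective_id (fun i j => adj.counit_naturality (f i j)) }
  left_triangle_components M := by
    refine (congrArg (· ≫ _) (mapMatHom_reindex L _ _)).trans ?_
    refine (reindex_comp_reindex _ _ _ _).trans (Eq.trans ?_ (id_eq_reindex _).symm)
    exact congrArg (reindex (M := mapMatObj L M) (N := mapMatObj L M) id)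
      (funext fun i => adj.left_triangle_components (M.X i))
  right_triangle_components M := by
    refine (congrArg (_ ≫ ·) (mapMatHom_reindex R _ _)).trans ?_
    refine (reindex_comp_reindex _ _ _ _).trans (Eq.trans ?_ (id_eq_reindex _).symm)
    exact congrArg (reindex (M := mapMatObj R M) (N := mapMatObj R M) id)
      (funext fun i => adj.right_triangle_components (M.X i))

/-- An adjunction induces one of idempotent completions. The unit at `(X, p)` is `p ≫ η`, and the
counit is `ε ≫ p`. -/
def adjunctionMapKaroubi {C : Type u} [Category.{v} C] {D : Type u'} [Category.{v'} D]
    {L : C ⥤ D} {R : D ⥤ C} (adj : L ⊣ R) : mapKaroubi L ⊣ mapKaroubi R where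
  unit :=
    { app P := ⟨P.p ≫ adj.unit.app P.X, by
        change P.p ≫ (P.p ≫ adj.unit.app P.X) ≫ R.map (L.map P.p) = _
        rw [Category.assoc, adj.unit_naturality, P.idem_assoc, P.idem_assoc]
        rfl⟩
      naturality {P Q} f := by
        apply Karoubi.hom_ext
        change f.f ≫ Q.p ≫ adj.unit.app Q.X =
          (P.p ≫ adj.unit.app P.X) ≫ R.map (L.map f.f)
        rw [Category.assoc, adj.unit_naturality, ← Category.assoc, ← Category.assoc,
          Karoubi.comp_p, Karoubi.p_comp] }
  counit :=
    { app P := ⟨adj.counit.app P.X ≫ P.p, by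
        change L.map (R.map P.p) ≫ (adj.counit.app P.X ≫ P.p) ≫ P.p = _
        rw [Category.assoc, P.idem, adj.counit_naturality_assoc, P.idem]
        rfl⟩
      naturality {P Q} f := by
        apply Karoubi.hom_ext
        change L.map (R.map f.f) ≫ adj.counit.app Q.X ≫ Q.p =
          (adj.counit.app P.X ≫ P.p) ≫ f.f
        rw [Category.assoc, adj.counit_naturality_assoc, Karoubi.comp_p, Karoubi.p_comp] }
  left_triangle_components P := by
    apply Karoubi.hom_ext
    change L.map (P.p ≫ adj.unit.app P.X) ≫ adj.counit.app (L.obj P.X) ≫ L.map P.p = L.map P.p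
    rw [L.map_comp, Category.assoc, adj.left_triangle_components_assoc, ← L.map_comp, P.idem]
  right_triangle_components P := by
    apply Karoubi.hom_ext
    change (R.map P.p ≫ adj.unit.app (R.obj P.X)) ≫ R.map (adj.counit.app P.X ≫ P.p) = R.map P.p
    rw [R.map_comp, Category.assoc, adj.right_triangle_components_assoc, ← R.map_comp, P.idem]

end DeligneKnop

theorem mainTheorem3 {K : Type w} [Field K]
    {A : Type u} [Category.{v} A] {A' : Type u'} [Category.{v'} A']
    [DeligneKnop.RegularCat A] [DeligneKnop.RegularCat A']
    (δ : DeligneKnop.DegreeFunction K A) (δ' : DeligneKnop.DegreeFunction K A')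
    (F : A ⥤ A') (G : A' ⥤ A) (adj : G ⊣ F)
    (hF : DeligneKnop.PreservesDegree F δ δ') (hG : DeligneKnop.PreservesDegree G δ' δ)
    (hGp : DeligneKnop.PreservesPullbacks G)
    (hη : ∀ {x' y' : A'} (f' : x' ⟶ y'),
      IsPullback (adj.unit.app x') f' (F.map (G.map f')) (adj.unit.app y'))
    (hε : ∀ {x y : A} (f : x ⟶ y),
      IsPullback (adj.counit.app x) (G.map (F.map f)) f (adj.counit.app y)) :
    (DeligneKnop.inducedFunctor (DeligneKnop.preservesPullbacks_of_adjunction adj) hF).Additive ∧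
    (DeligneKnop.inducedFunctor (DeligneKnop.preservesPullbacks_of_adjunction adj) hF).Linear K ∧
    (∀ [CartesianMonoidalCategory A] [BraidedCategory A]
      [CartesianMonoidalCategory A'] [BraidedCategory A'],
      Nonempty (DeligneKnop.inducedFunctor
        (DeligneKnop.preservesPullbacks_of_adjunction adj) hF).Braided) ∧
    PreservesLimitsOfSize.{w₁, w₂}
      (DeligneKnop.inducedFunctor (DeligneKnop.preservesPullbacks_of_adjunction adj) hF) := by
  refine ⟨inferInstance, inferInstance, ?_, ?_⟩
  · intro _ _ _ _
    have := adj.rightAdjoint_preservesLimits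
    have := Functor.Braided.ofChosenFiniteProducts F
    exact ⟨inferInstance⟩
  · exact (DeligneKnop.adjunctionMapKaroubi (DeligneKnop.adjunctionMapMat
      (DeligneKnop.adjunctionSkeletal adj _ hF hGp hG hη hε))).rightAdjoint_preservesLimits
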